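/- **Theorem 3.1.** Let $\Bbbk$ be a field of arbitrary characteristic. Let $A$ be a cocommutative algebra: a unital associative $\Bbbk$-algebra with a coassociative, cocommutative algebra map $\Delta : A \to A\otimes A$, $\Delta(a)=\sum a_{(1)}\otimes a_{(2)}$ (in particular $\Delta(1)=1\otimes 1$; no counit is required). Let $V$ be an $A$-module (over $\Bbbk$), and let $\lambda : A\otimes V\to A$ and $\kappa=\kappa_V\oplus\kappa_A : \wedge^2 V\to V\oplus A$ be $\Bbbk$-linear. Let $\mathscr H_{\lambda,\kappa}$ be the quotient of the tensor algebra $T(V\oplus A)$ by the multiplication of $A$ (including $1_A=1$) and the relations $$ a v-\sum a_{(1)}(v)\,a_{(2)}=\lambda(a,v),\qquad v v'-v'v=\kappa(v,v')\qquad (a\in A,\ v,v'\in V), $$ filtered by $\deg A=0$, $\deg V=1$, and let $B:=\mathscr H_{0,0}=\mathrm{Sym}(V)\rtimes A$, which is graded in the same way. We say that $\mathscr H_{\lambda,\kappa}$ has the *PBW property* if the canonical surjection from $B$ to the associated graded algebra of $\mathscr H_{\lambda,\kappa}$ is an isomorphism. A *graded $\Bbbk[t]$-deformation* of $B$ is an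 associative $\Bbbk[t]$-algebra $(B_t,*)$ together with a $\Bbbk[t]$-module isomorphism $B_t\cong B[t]$ inducing an algebra isomorphism $B_t/tB_t\cong B$, such that, writing $b*b'=bb'+\sum_{j>0}\mu_j(b\otimes b')t^j$ for $b,b'\in B$, each $\mu_j:B\otimes B\to B$ is homogeneous of degree $-j$. Consider the two statements: 1. $\mathscr H_{\lambda,\kappa}$ has the PBW property. 2. There is a graded $\Bbbk[t]$-deformation $B_t$ of $B$ whose multiplication maps satisfy, for all $a\in A$ and $v,v'\in V$, $$ \begin{aligned}\lambda(a,v)&=\mu_1(a\otimes v)-\sum\mu_1(a_{(1)}(v)\otimes a_{(2)}),\\ \kappa_V(v,v')&=\mu_1(v\otimes v')-\mu_1(v'\otimes v),\\ \kappa_A(v,v')&=\mu_2(v\otimes v')-\mu_2(v'\otimes v).\end{aligned} $$ Then (1) implies (2), and (2) implies (1) if $A$ and $V$ are finite-dimensional. Moreover, if (1) holds, then for every $B_t$ as in (2) there is a $\Bbbk$-algebra isomorphism $\mathscr H_{\lambda,\kappa}\cong B_t|_{t=1}:=B_t/(t-1)B_t$ that sends the generators $a\in A$ and $v\in V$ to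 the classes of $a$ and $v$. -/

import Mathlib

open scoped TensorProduct Polynomial

universe u v w

noncomputable section

namespace PBWDeform

/-! ### Cocommutative algebras -/

/-- A cocommutative coproduct on a unital associative `k`-algebra `A`: an algebra map
`Δ : A → A ⊗ A` (so `Δ 1 = 1 ⊗ 1`), coassociative, with `Δ = Δᵒᵖ`. No counit is required. -/
structure CocommutativeCoproduct (k : Type u) (A : Type v)
    [CommRing k] [Ring A] [Algebra k A] where
  comul : A →ₐ[k] A ⊗[k] A
  coassoc : ∀ a : A, TensorProduct.assoc k A A A (comul.toLinearMap.rTensor A (comul a)) =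
    comul.toLinearMap.lTensor A (comul a)
  cocomm : ∀ a : A, TensorProduct.comm k A A (comul a) = comul a

section Algebras

variable {k : Type u} {A : Type v} {V : Type w}
  [CommRing k] [Ring A] [Algebra k A] [AddCommGroup V] [Module k V] [Module A V]
  [IsScalarTower k A V]

/-- For a `k`-bilinear map `β : V × A → M` and `v : V`, the linear map
`A ⊗ A → M`, `a₁ ⊗ a₂ ↦ β (a₁(v), a₂)`. Applied to `Δ a` it is the Sweedler sum
`∑ β (a₍₁₎(v), a₍₂₎)`. -/
def sweedlerSum {M : Type*} [AddCommGroup M] [Module k M] (β : V →ₗ[k] A →ₗ[k] M) (v : V) :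
    A ⊗[k] A →ₗ[k] M :=
  TensorProduct.lift (β ∘ₗ (LinearMap.toSpanSingleton A V v).restrictScalars k)

@[simp]
theorem sweedlerSum_tmul {M : Type*} [AddCommGroup M] [Module k M]
    (β : V →ₗ[k] A →ₗ[k] M) (v : V) (a₁ a₂ : A) :
    sweedlerSum β v (a₁ ⊗ₜ[k] a₂) = β (a₁ • v) a₂ := by
  simp [sweedlerSum]

variable (k A V) in
/-- The inclusion `V → T(V ⊕ A)`. -/
def tV : V →ₗ[k] TensorAlgebra k (V × A) := TensorAlgebra.ι k ∘ₗ LinearMap.inl k V A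

variable (k A V) in
/-- The inclusion `A → T(V ⊕ A)`. -/
def tA : A →ₗ[k] TensorAlgebra k (V × A) := TensorAlgebra.ι k ∘ₗ LinearMap.inr k V A

/-! ### Deformed smash product algebras

The parameter `κ : ∧² V → V ⊕ A` is an alternating bilinear map with values in `V × A`; its
components are `κ_V` and `κ_A`. -/

/-- `κ_V`, the projection of `κ` to `V`. -/
def kappaV (κ : V [⋀^Fin 2]→ₗ[k] (V × A)) (v v' : V) : V := (κ ![v, v']).1

/-- `κ_A`, the projection of `κ` to `A`. -/
def kappaA (κ : V [⋀^Fin 2]→ₗ[k] (V × A)) (v v' : V) : A := (κ ![v, v']).2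

/-- The defining relations on `T(V ⊕ A)`: the multiplication of `A` (including its unit), and
`a v - ∑ a₍₁₎(v) a₍₂₎ = λ(a, v)`, `v v' - v' v = κ(v, v')`. -/
inductive SmashRel (Δ : CocommutativeCoproduct k A) (lam : A →ₗ[k] V →ₗ[k] A)
    (κ : V [⋀^Fin 2]→ₗ[k] (V × A)) :
    TensorAlgebra k (V × A) → TensorAlgebra k (V × A) → Prop
  | one : SmashRel Δ lam κ (tA k A V 1) 1
  | mul (a a' : A) : SmashRel Δ lam κ (tA k A V a * tA k A V a') (tA k A V (a * a'))
  | act (a : A) (v : V) : SmashRel Δ lam κ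
      (tA k A V a * tV k A V v -
        sweedlerSum ((LinearMap.mul k (TensorAlgebra k (V × A))).compl₁₂ (tV k A V) (tA k A V)) v
          (Δ.comul a))
      (tA k A V (lam a v))
  | comm (v v' : V) : SmashRel Δ lam κ
      (tV k A V v * tV k A V v' - tV k A V v' * tV k A V v)
      (tV k A V (kappaV κ v v') + tA k A V (kappaA κ v v'))

/-- The deformed smash product algebra `ℋ_{λ,κ}(A, V)`. -/
def DeformedSmash (Δ : CocommutativeCoproduct k A) (lam : A →ₗ[k] V →ₗ[k] A)
    (κ : V [⋀^Fin 2]→ₗ[k] (V × A)) : Type (max u v w) :=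
  RingQuot (SmashRel Δ lam κ)

instance (Δ : CocommutativeCoproduct k A) (lam : A →ₗ[k] V →ₗ[k] A)
    (κ : V [⋀^Fin 2]→ₗ[k] (V × A)) : Ring (DeformedSmash Δ lam κ) :=
  inferInstanceAs (Ring (RingQuot (SmashRel Δ lam κ)))

instance (Δ : CocommutativeCoproduct k A) (lam : A →ₗ[k] V →ₗ[k] A)
    (κ : V [⋀^Fin 2]→ₗ[k] (V × A)) : Algebra k (DeformedSmash Δ lam κ) :=
  inferInstanceAs (Algebra k (RingQuot (SmashRel Δ lam κ)))

/-- The quotient map `T(V ⊕ A) → ℋ_{λ,κ}`. -/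
def DeformedSmash.mk (Δ : CocommutativeCoproduct k A) (lam : A →ₗ[k] V →ₗ[k] A)
    (κ : V [⋀^Fin 2]→ₗ[k] (V × A)) :
    TensorAlgebra k (V × A) →ₐ[k] DeformedSmash Δ lam κ :=
  RingQuot.mkAlgHom k (SmashRel Δ lam κ)

variable (V) in
/-- The undeformed algebra `ℋ_{0,0}(A, V) = Sym(V) ⋊ A`: the relations are those of `A`,
`a v = ∑ a₍₁₎(v) a₍₂₎` and `v v' = v' v`. -/
abbrev SmashSym (Δ : CocommutativeCoproduct k A) : Type (max u v w) :=
  DeformedSmash (V := V) Δ 0 0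

variable (Δ : CocommutativeCoproduct k A) (lam : A →ₗ[k] V →ₗ[k] A)
    (κ : V [⋀^Fin 2]→ₗ[k] (V × A))

/-- The natural map `V → ℋ_{λ,κ}`. -/
def ofV : V →ₗ[k] DeformedSmash Δ lam κ :=
  (DeformedSmash.mk Δ lam κ).toLinearMap ∘ₗ tV k A V

/-- The natural map `A → ℋ_{λ,κ}`. -/
def ofA : A →ₗ[k] DeformedSmash Δ lam κ :=
  (DeformedSmash.mk Δ lam κ).toLinearMap ∘ₗ tA k A V

/-- The element of `ℋ_{λ,κ}` represented by a word in the letters `V ⊔ A`. -/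
def word (l : List (V ⊕ A)) : DeformedSmash Δ lam κ :=
  (l.map (Sum.elim (ofV Δ lam κ) (ofA Δ lam κ))).prod

/-- The degree of a word: letters from `V` have degree `1`, letters from `A` degree `0`. -/
def wordDeg (l : List (V ⊕ A)) : ℕ := l.countP Sum.isLeft

/-- The filtration `F_n` of `ℋ_{λ,κ}` with `deg A = 0`, `deg V = 1`. -/
def filt (n : ℕ) : Submodule k (DeformedSmash Δ lam κ) :=
  Submodule.span k {x | ∃ l : List (V ⊕ A), wordDeg l ≤ n ∧ word Δ lam κ l = x}

/-- The previous step `F_{n-1}` of the filtration (`F_{-1} = 0`). -/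
def filtLT (n : ℕ) : Submodule k (DeformedSmash Δ lam κ) :=
  Submodule.span k {x | ∃ l : List (V ⊕ A), wordDeg l < n ∧ word Δ lam κ l = x}

/-- The `n`-th component `F_n / F_{n-1}` of the associated graded algebra of `ℋ_{λ,κ}`. -/
abbrev GrPiece (n : ℕ) : Type (max u v w) :=
  filt Δ lam κ n ⧸ (filtLT Δ lam κ n).submoduleOf (filt Δ lam κ n)

variable (V) in
/-- The grading of `Sym(V) ⋊ A` with `deg A = 0`, `deg V = 1`. -/
def grading (n : ℕ) : Submodule k (SmashSym V Δ) :=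
  Submodule.span k {x | ∃ l : List (V ⊕ A), wordDeg l = n ∧ word Δ 0 0 l = x}

theorem word_mem_filt (l : List (V ⊕ A)) : word Δ lam κ l ∈ filt Δ lam κ (wordDeg l) :=
  Submodule.subset_span ⟨l, le_rfl, rfl⟩

theorem word_mem_grading (l : List (V ⊕ A)) : word Δ 0 0 l ∈ grading V Δ (wordDeg l) :=
  Submodule.subset_span ⟨l, rfl, rfl⟩

/-- The PBW property: the canonical surjection from `Sym(V) ⋊ A` onto the associated graded
algebra of `ℋ_{λ,κ}` is an isomorphism. The canonical surjection sends the class of a word of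
degree `n` to the class of the same word in `F_n / F_{n-1}`; as such words span the `n`-th
graded component this determines it, and it is multiplicative. -/
def HasPBW : Prop :=
  ∃ φ : ∀ n : ℕ, grading V Δ n ≃ₗ[k] GrPiece Δ lam κ n,
    ∀ l : List (V ⊕ A),
      φ (wordDeg l) ⟨word Δ 0 0 l, word_mem_grading Δ l⟩ =
        Submodule.Quotient.mk ⟨word Δ lam κ l, word_mem_filt Δ lam κ l⟩

end Algebras

/-! ### Deformations over `k[t]` -/

/-- A deformation of `B` over `k[t]`: an associative `k[t]`-algebra `B_t` with a `k[t]`-linear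
isomorphism `B_t ≃ B[t]` (that is, `k`-linear and commuting with `t`) whose reduction modulo `t`
is an algebra isomorphism `B_t / t B_t ≃ B`: the surjection `B_t → B`, with kernel `t B_t`,
taking the constant coefficient, is a homomorphism of `k`-algebras. -/
structure Deformation (k : Type u) (B : Type v) [Field k] [Ring B] [Algebra k B] where
  carrier : Type v
  [ring : Ring carrier]
  [algebraBase : Algebra k carrier]
  [algebra : Algebra k[X] carrier]
  [tower : IsScalarTower k k[X] carrier]
  equiv : carrier ≃ₗ[k] B[X]
  equiv_t : ∀ x : carrier, equiv ((Polynomial.X : k[X]) • x) = Polynomial.X * equiv x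
  coeff_zero_one : (equiv 1).coeff 0 = 1
  coeff_zero_mul : ∀ x y : carrier,
    (equiv (x * y)).coeff 0 = (equiv x).coeff 0 * (equiv y).coeff 0

attribute [instance] Deformation.ring Deformation.algebraBase Deformation.algebra
  Deformation.tower

namespace Deformation

variable {k : Type u} {B : Type v} [Field k] [Ring B] [Algebra k B] (D : Deformation k B)

/-- The inclusion of `B = B ⊗ t⁰` in `B_t ≃ B[t]`. -/
def incl : B →ₗ[k] D.carrier :=
  D.equiv.symm.toLinearMap ∘ₗ (Polynomial.CAlgHom (R := k) (A := B)).toLinearMap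

/-- The `j`-th multiplication map `μ_j : B ⊗ B → B`: the coefficient of `t ^ j` in the product
`b * c` formed in `B_t`. -/
def mu (j : ℕ) : B →ₗ[k] B →ₗ[k] B :=
  ((LinearMap.mul k D.carrier).compl₁₂ D.incl D.incl).compr₂
    (((Polynomial.lcoeff B j).restrictScalars k) ∘ₗ D.equiv.toLinearMap)

theorem mu_apply (j : ℕ) (b c : B) :
    D.mu j b c = (D.equiv (D.equiv.symm (Polynomial.C b) * D.equiv.symm (Polynomial.C c))).coeff j :=
  rfl

/-- For an `ℕ`-graded algebra `B = ⨁ 𝒢 n`, the deformation is graded (with `deg t = 1`) if each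
`μ_j` is homogeneous of degree `-j`. -/
def IsGraded (𝒢 : ℕ → Submodule k B) : Prop :=
  ∀ j m n : ℕ, ∀ b ∈ 𝒢 m, ∀ c ∈ 𝒢 n,
    (∀ p, p + j = m + n → D.mu j b c ∈ 𝒢 p) ∧ (m + n < j → D.mu j b c = 0)

/-- The specialization `B_t |_{t = 1} = B_t / (t - 1) B_t`. -/
def AtOne : Type v :=
  RingQuot fun x y : D.carrier => x = algebraMap k[X] D.carrier Polynomial.X ∧ y = 1

instance : Ring D.AtOne :=
  inferInstanceAs (Ring (RingQuot fun x y : D.carrier =>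
    x = algebraMap k[X] D.carrier Polynomial.X ∧ y = 1))

instance : Algebra k D.AtOne :=
  inferInstanceAs (Algebra k (RingQuot fun x y : D.carrier =>
    x = algebraMap k[X] D.carrier Polynomial.X ∧ y = 1))

/-- The quotient map `B_t → B_t |_{t = 1}`. -/
def mkAtOne : D.carrier →ₐ[k] D.AtOne :=
  RingQuot.mkAlgHom k fun x y : D.carrier =>
    x = algebraMap k[X] D.carrier Polynomial.X ∧ y = 1

/-- The map `B → B_t |_{t = 1}`, `b ↦ b ⊗ t⁰`. -/
def toAtOne : B →ₗ[k] D.AtOne :=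
  D.mkAtOne.toLinearMap ∘ₗ D.incl

end Deformation

/-- The deformation `B_t` of `B = Sym(V) ⋊ A` recovers `λ, κ_V, κ_A`:
`λ(a, v) = μ₁(a ⊗ v) - ∑ μ₁(a₍₁₎(v) ⊗ a₍₂₎)`, `κ_V(v, v') = μ₁(v ⊗ v') - μ₁(v' ⊗ v)`,
`κ_A(v, v') = μ₂(v ⊗ v') - μ₂(v' ⊗ v)`, as identities in `B`. -/
structure Recovers {k : Type u} {A : Type v} {V : Type w} [Field k] [Ring A] [Algebra k A]
    [AddCommGroup V] [Module k V] [Module A V] [IsScalarTower k A V]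
    (Δ : CocommutativeCoproduct k A) (lam : A →ₗ[k] V →ₗ[k] A)
    (κ : V [⋀^Fin 2]→ₗ[k] (V × A)) (D : Deformation k (SmashSym V Δ)) : Prop where
  lam_eq : ∀ (a : A) (v : V),
    ofA Δ 0 0 (lam a v) = D.mu 1 (ofA Δ 0 0 a) (ofV Δ 0 0 v) -
      sweedlerSum ((D.mu 1).compl₁₂ (ofV Δ 0 0) (ofA Δ 0 0)) v (Δ.comul a)
  kappaV_eq : ∀ v v' : V,
    ofV Δ 0 0 (kappaV κ v v') =
      D.mu 1 (ofV Δ 0 0 v) (ofV Δ 0 0 v') - D.mu 1 (ofV Δ 0 0 v') (ofV Δ 0 0 v)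
  kappaA_eq : ∀ v v' : V,
    ofA Δ 0 0 (kappaA κ v v') =
      D.mu 2 (ofV Δ 0 0 v) (ofV Δ 0 0 v') - D.mu 2 (ofV Δ 0 0 v') (ofV Δ 0 0 v)

end PBWDeform

end

noncomputable section

namespace PBWDeform

section Words

variable {k : Type u} {A : Type v} {V : Type w}

/-! Write `F` for the filtration of `ℋ = ℋ_{λ,κ}`, `B` for `Sym(V) ⋊ A`, and `*` for the product of
`B_t`.

From PBW to a deformation: take the Rees algebra `⨁ F_n Xⁿ ⊆ ℋ[X]`, with `t` acting as the central
element `X`. Its quotient by `⨁ F_{n-1} Xⁿ`, the multiples of `X`, is the associated graded algebra,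
which PBW identifies with `B` (`FilteredLift.toGr_injective`). Choosing filtered linear lifts of the
homogeneous elements of `B` and extending them `X`-linearly gives `B[X] ≃ rees`
(`polyToRees_injective`, `polyToRees_surjective`). In the Rees algebra the relations become `a v - ∑
a₍₁₎(v) a₍₂₎ = X λ(a, v)` and `v v' - v' v = X κ_V(v, v') + X² κ_A(v, v')`, so `λ`, `κ_V`, `κ_A` are
read off as coefficients (`deformation_recovers`). This needs lifts sending `V` exactly to the
generators, which is possible because `V → B` is injective (`ofV_injective`).

From a deformation to PBW: at `t = 1` the algebra `B_t` becomes the space `B` with product `b c + ∑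
μ_j(b, c)`, where the `μ_j` lower degree. The recovery formulas say that the generators satisfy the
relations of `ℋ` there, which gives `toSpecialization : ℋ → B_t|_{t=1}`. It sends a word to the same
word of `B` up to lower degree (`toSpecialization_word_sub_mem`). Hence an element of `B` killed by
the canonical surjection has zero top part, which is PBW, and induction along the filtration makes
the map bijective, which is the isomorphism. -/

theorem wordDeg_append (l l' : List (V ⊕ A)) : wordDeg (l ++ l') = wordDeg l + wordDeg l' := by
  simp [wordDeg]

theorem wordDeg_cons (x : V ⊕ A) (l : List (V ⊕ A)) :
    wordDeg (x :: l) = wordDeg [x] + wordDeg l := wordDeg_append [x] l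

@[simp]
theorem wordDeg_nil : wordDeg ([] : List (V ⊕ A)) = 0 := rfl

@[simp]
theorem wordDeg_inl (v : V) : wordDeg [(Sum.inl v : V ⊕ A)] = 1 := rfl

@[simp]
theorem wordDeg_inr (a : A) : wordDeg [(Sum.inr a : V ⊕ A)] = 0 := rfl

@[simp]
theorem kappaV_zero [CommRing k] [Ring A] [Algebra k A] [AddCommGroup V] [Module k V]
    (v v' : V) : kappaV (0 : V [⋀^Fin 2]→ₗ[k] (V × A)) v v' = 0 := rfl

@[simp]
theorem kappaA_zero [CommRing k] [Ring A] [Algebra k A] [AddCommGroup V] [Module k V]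
    (v v' : V) : kappaA (0 : V [⋀^Fin 2]→ₗ[k] (V × A)) v v' = 0 := rfl

end Words

/-! ### Universal property and relations of `ℋ_{λ,κ}` -/

section Basics

variable {k : Type u} {A : Type v} {V : Type w}
  [CommRing k] [Ring A] [Algebra k A] [AddCommGroup V] [Module k V] [Module A V]
  [IsScalarTower k A V]

/-- Both sides are linear in `x` and agree on pure tensors. This carries the Sweedler relation
through every linear map used below. -/
theorem map_sweedlerSum {M N : Type*} [AddCommGroup M] [Module k M] [AddCommGroup N] [Module k N]
    (g : M →ₗ[k] N) (β : V →ₗ[k] A →ₗ[k] M) (v : V) (x : A ⊗[k] A) :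
    g (sweedlerSum β v x) = sweedlerSum (β.compr₂ g) v x := by
  induction x using TensorProduct.induction_on with
  | zero => simp
  | tmul a b => simp
  | add x y hx hy => simp [hx, hy]

variable {Δ : CocommutativeCoproduct k A} {lam : A →ₗ[k] V →ₗ[k] A} {κ : V [⋀^Fin 2]→ₗ[k] (V × A)}

/-- The universal property of `ℋ_{λ,κ}`. -/
def DeformedSmash.lift {C : Type*} [Ring C] [Algebra k C] (fA : A →ₗ[k] C) (fV : V →ₗ[k] C)
    (h_one : fA 1 = 1) (h_mul : ∀ a b, fA a * fA b = fA (a * b))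
    (h_act : ∀ a v, fA a * fV v -
      sweedlerSum ((LinearMap.mul k C).compl₁₂ fV fA) v (Δ.comul a) = fA (lam a v))
    (h_comm : ∀ v v', fV v * fV v' - fV v' * fV v = fV (kappaV κ v v') + fA (kappaA κ v v')) :
    DeformedSmash Δ lam κ →ₐ[k] C :=
  RingQuot.liftAlgHom k ⟨TensorAlgebra.lift k (fV.coprod fA), by
    have hV (v : V) : TensorAlgebra.lift k (fV.coprod fA) (tV k A V v) = fV v := by simp [tV]
    have hA (a : A) : TensorAlgebra.lift k (fV.coprod fA) (tA k A V a) = fA a := by simp [tA]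
    intro x y h
    cases h with
    | one => simp [hA, h_one]
    | mul a b => simp [hA, h_mul]
    | act a v =>
      rw [map_sub, map_mul, hA, hV, hA, ← h_act]
      congr 1
      refine (map_sweedlerSum (TensorAlgebra.lift k (fV.coprod fA)).toLinearMap _ _ _).trans ?_
      congr 1
      ext v a
      simp [hA, hV]
    | comm v v' => simp [hA, hV, h_comm]⟩

section lift
variable {C : Type*} [Ring C] [Algebra k C] {fA : A →ₗ[k] C} {fV : V →ₗ[k] C}
    {h_one : fA 1 = 1} {h_mul : ∀ a b, fA a * fA b = fA (a * b)}
    {h_act : ∀ a v, fA a * fV v -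
      sweedlerSum ((LinearMap.mul k C).compl₁₂ fV fA) v (Δ.comul a) = fA (lam a v)}
    {h_comm : ∀ v v', fV v * fV v' - fV v' * fV v = fV (kappaV κ v v') + fA (kappaA κ v v')}

@[simp]
theorem DeformedSmash.lift_ofA (a : A) :
    DeformedSmash.lift fA fV h_one h_mul h_act h_comm (ofA Δ lam κ a) = fA a := by
  refine (RingQuot.liftAlgHom_mkAlgHom_apply k _ _ _).trans ?_
  simp [tA]

@[simp]
theorem DeformedSmash.lift_ofV (x : V) :
    DeformedSmash.lift fA fV h_one h_mul h_act h_comm (ofV Δ lam κ x) = fV x := by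
  refine (RingQuot.liftAlgHom_mkAlgHom_apply k _ _ _).trans ?_
  simp [tV]

end lift

variable (Δ lam κ)

theorem ofA_one : ofA Δ lam κ 1 = 1 :=
  (RingQuot.mkAlgHom_rel k (SmashRel.one (Δ := Δ) (lam := lam) (κ := κ))).trans (map_one _)

theorem ofA_mul (a b : A) : ofA Δ lam κ a * ofA Δ lam κ b = ofA Δ lam κ (a * b) :=
  (map_mul (DeformedSmash.mk Δ lam κ) _ _).symm.trans
    (RingQuot.mkAlgHom_rel k (SmashRel.mul (Δ := Δ) (lam := lam) (κ := κ) a b))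

theorem ofA_mul_ofV (a : A) (v : V) : ofA Δ lam κ a * ofV Δ lam κ v -
    sweedlerSum ((LinearMap.mul k _).compl₁₂ (ofV Δ lam κ) (ofA Δ lam κ)) v (Δ.comul a) =
      ofA Δ lam κ (lam a v) := by
  have h : DeformedSmash.mk Δ lam κ _ = DeformedSmash.mk Δ lam κ _ :=
    RingQuot.mkAlgHom_rel k (SmashRel.act (Δ := Δ) (lam := lam) (κ := κ) a v)
  refine Eq.trans ?_ h
  rw [map_sub, map_mul]
  congr 1
  refine Eq.trans ?_ (map_sweedlerSum (DeformedSmash.mk Δ lam κ).toLinearMap _ _ _).symm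
  congr 1
  ext v a
  simp [ofV, ofA]

theorem ofV_mul_ofV (v v' : V) : ofV Δ lam κ v * ofV Δ lam κ v' - ofV Δ lam κ v' * ofV Δ lam κ v =
    ofV Δ lam κ (kappaV κ v v') + ofA Δ lam κ (kappaA κ v v') := by
  have h : DeformedSmash.mk Δ lam κ _ = DeformedSmash.mk Δ lam κ _ :=
    RingQuot.mkAlgHom_rel k (SmashRel.comm (Δ := Δ) (lam := lam) (κ := κ) v v')
  simpa [ofV, ofA] using h

/-! ### Words and the filtration -/

@[simp]
theorem word_nil : word Δ lam κ [] = 1 := rfl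

theorem word_cons (x : V ⊕ A) (l : List (V ⊕ A)) : word Δ lam κ (x :: l) =
    Sum.elim (ofV Δ lam κ) (ofA Δ lam κ) x * word Δ lam κ l := by simp [word]

theorem word_append (l l' : List (V ⊕ A)) :
    word Δ lam κ (l ++ l') = word Δ lam κ l * word Δ lam κ l' := by simp [word]

theorem word_inl (v : V) : word Δ lam κ [Sum.inl v] = ofV Δ lam κ v := by simp [word]

theorem word_inr (a : A) : word Δ lam κ [Sum.inr a] = ofA Δ lam κ a := by simp [word]

theorem filt_mono {m n : ℕ} (h : m ≤ n) : filt Δ lam κ m ≤ filt Δ lam κ n :=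
  Submodule.span_mono fun _ ⟨l, hl, e⟩ => ⟨l, hl.trans h, e⟩

theorem filtLT_succ (n : ℕ) : filtLT Δ lam κ (n + 1) = filt Δ lam κ n := by
  simp [filt, filtLT]

theorem filtLT_zero : filtLT Δ lam κ 0 = ⊥ := by simp [filtLT]

theorem filtLT_mono {m n : ℕ} (h : m ≤ n) : filtLT Δ lam κ m ≤ filtLT Δ lam κ n :=
  Submodule.span_mono fun _ ⟨l, hl, e⟩ => ⟨l, hl.trans_le h, e⟩

theorem filtLT_le_filt (n : ℕ) : filtLT Δ lam κ n ≤ filt Δ lam κ n :=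
  Submodule.span_mono fun _ ⟨l, hl, e⟩ => ⟨l, hl.le, e⟩

theorem grading_le_filtLT {m n : ℕ} (h : m < n) : grading V Δ m ≤ filtLT Δ 0 0 n :=
  Submodule.span_mono fun _ ⟨l, hl, e⟩ => ⟨l, hl.trans_lt h, e⟩

theorem filt_mul_mem {m n : ℕ} {x y : DeformedSmash Δ lam κ} (hx : x ∈ filt Δ lam κ m)
    (hy : y ∈ filt Δ lam κ n) : x * y ∈ filt Δ lam κ (m + n) := by
  refine (?_ : filt Δ lam κ m * filt Δ lam κ n ≤ _) (Submodule.mul_mem_mul hx hy)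
  rw [filt, filt, Submodule.span_mul_span, Submodule.span_le]
  rintro _ ⟨_, ⟨l, hl, rfl⟩, _, ⟨l', hl', rfl⟩, rfl⟩
  exact Submodule.subset_span ⟨l ++ l', by rw [wordDeg_append]; omega, word_append ..⟩

theorem filtLT_mul_filt_mem {m n : ℕ} {x y : DeformedSmash Δ lam κ} (hx : x ∈ filtLT Δ lam κ m)
    (hy : y ∈ filt Δ lam κ n) : x * y ∈ filtLT Δ lam κ (m + n) := by
  cases m with
  | zero =>
    rw [filtLT_zero, Submodule.mem_bot] at hx
    simp [hx]
  | succ m =>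
    rw [filtLT_succ] at hx
    rw [Nat.succ_add, filtLT_succ]
    exact filt_mul_mem Δ lam κ hx hy

theorem filt_mul_filtLT_mem {m n : ℕ} {x y : DeformedSmash Δ lam κ} (hx : x ∈ filt Δ lam κ m)
    (hy : y ∈ filtLT Δ lam κ n) : x * y ∈ filtLT Δ lam κ (m + n) := by
  cases n with
  | zero =>
    rw [filtLT_zero, Submodule.mem_bot] at hy
    simp [hy]
  | succ n =>
    rw [filtLT_succ] at hy
    rw [← Nat.add_assoc, filtLT_succ]
    exact filt_mul_mem Δ lam κ hx hy

theorem one_mem_filt : (1 : DeformedSmash Δ lam κ) ∈ filt Δ lam κ 0 :=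
  word_mem_filt Δ lam κ []

theorem ofA_mem_filt (a : A) : ofA Δ lam κ a ∈ filt Δ lam κ 0 :=
  word_inr Δ lam κ a ▸ word_mem_filt Δ lam κ [Sum.inr a]

theorem ofV_mem_filt (v : V) : ofV Δ lam κ v ∈ filt Δ lam κ 1 :=
  word_inl Δ lam κ v ▸ word_mem_filt Δ lam κ [Sum.inl v]

theorem ofA_mem_grading (a : A) : ofA Δ 0 0 a ∈ grading V Δ 0 :=
  word_inr (V := V) Δ 0 0 a ▸ word_mem_grading Δ [Sum.inr a]

theorem ofV_mem_grading (v : V) : ofV Δ 0 0 v ∈ grading V Δ 1 :=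
  word_inl Δ 0 0 v ▸ word_mem_grading Δ [Sum.inl v]

theorem one_mem_grading : (1 : SmashSym V Δ) ∈ grading V Δ 0 :=
  word_mem_grading (V := V) Δ []

theorem span_range_word : Submodule.span k (Set.range (word Δ lam κ)) = ⊤ := by
  rw [eq_top_iff]
  intro x _
  obtain ⟨x, rfl⟩ : ∃ y, DeformedSmash.mk Δ lam κ y = x :=
    RingQuot.mkAlgHom_surjective k (SmashRel Δ lam κ) x
  induction x using TensorAlgebra.induction with
  | algebraMap r =>
    rw [AlgHom.commutes, Algebra.algebraMap_eq_smul_one]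
    exact Submodule.smul_mem _ _ (Submodule.subset_span ⟨[], rfl⟩)
  | ι x =>
    have : TensorAlgebra.ι k x = tV k A V x.1 + tA k A V x.2 := by simp [tV, tA, ← map_add]
    rw [this, map_add]
    exact add_mem (Submodule.subset_span ⟨[Sum.inl x.1], word_inl ..⟩)
      (Submodule.subset_span ⟨[Sum.inr x.2], word_inr ..⟩)
  | mul x y hx hy =>
    rw [map_mul]
    refine (?_ : Submodule.span k (Set.range (word Δ lam κ)) * _ ≤ _)
      (Submodule.mul_mem_mul (hx trivial) (hy trivial))
    rw [Submodule.span_mul_span, Submodule.span_le]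
    rintro _ ⟨_, ⟨l, rfl⟩, _, ⟨l', rfl⟩, rfl⟩
    exact Submodule.subset_span ⟨l ++ l', word_append ..⟩
  | add x y hx hy =>
    rw [map_add]
    exact add_mem (hx trivial) (hy trivial)

/-- The filtration is exhaustive, since words span; this starts the inductions on degree. -/
theorem exists_mem_filtLT (x : DeformedSmash Δ lam κ) : ∃ n, x ∈ filtLT Δ lam κ n := by
  have hx : x ∈ Submodule.span k (Set.range (word Δ lam κ)) := by simp [span_range_word]
  induction hx using Submodule.span_induction with
  | mem x h =>
    obtain ⟨l, rfl⟩ := h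
    exact ⟨wordDeg l + 1, filtLT_succ Δ lam κ _ ▸ word_mem_filt Δ lam κ l⟩
  | zero => exact ⟨0, zero_mem _⟩
  | add x y _ _ hx hy =>
    obtain ⟨m, hm⟩ := hx
    obtain ⟨n, hn⟩ := hy
    exact ⟨max m n, add_mem (filtLT_mono Δ lam κ (le_max_left m n) hm)
      (filtLT_mono Δ lam κ (le_max_right m n) hn)⟩
  | smul r x _ hx =>
    obtain ⟨n, hn⟩ := hx
    exact ⟨n, Submodule.smul_mem _ _ hn⟩

/-- Linear maps out of `ℋ_{λ,κ}` are determined by their values on words. -/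
theorem linearMap_ext_word {M : Type*} [AddCommGroup M] [Module k M]
    {f g : DeformedSmash Δ lam κ →ₗ[k] M} (h : ∀ l, f (word Δ lam κ l) = g (word Δ lam κ l)) :
    f = g :=
  LinearMap.ext_on (span_range_word Δ lam κ) (by rintro _ ⟨l, rfl⟩; exact h l)

/-! ### The grading of `Sym(V) ⋊ A` -/

/-- The homomorphism `B → B[X]` with `b ↦ b X ^ n` on the component of degree `n`. -/
def gradingHom : SmashSym V Δ →ₐ[k] (SmashSym V Δ)[X] :=
  DeformedSmash.lift (((Polynomial.monomial 0).restrictScalars k) ∘ₗ ofA Δ 0 0)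
    (((Polynomial.monomial 1).restrictScalars k) ∘ₗ ofV Δ 0 0)
    (by simp [ofA_one])
    (fun a b => by simp [← ofA_mul])
    (by
      intro a v
      -- The action relation of `B` is homogeneous of degree one, so it may be multiplied by `X`.
      have h := congrArg ((Polynomial.monomial 1).restrictScalars k) (ofA_mul_ofV Δ 0 0 a v)
      rw [map_sub, map_sweedlerSum] at h
      simp only [LinearMap.zero_apply, map_zero] at h ⊢
      rw [← h]
      congr 1
      · simp
      · congr 2
        refine LinearMap.ext₂ fun v a => ?_
        simp)
    (by
      intro v v'
      have h := ofV_mul_ofV Δ 0 0 v v'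
      simp only [kappaV_zero, kappaA_zero, map_zero, add_zero, sub_eq_zero] at h
      simp [Polynomial.monomial_mul_monomial, h])

@[simp]
theorem gradingHom_ofA (a : A) :
    gradingHom (V := V) Δ (ofA Δ 0 0 a) = Polynomial.monomial 0 (ofA Δ 0 0 a) :=
  DeformedSmash.lift_ofA a

@[simp]
theorem gradingHom_ofV (v : V) :
    gradingHom Δ (ofV Δ 0 0 v) = Polynomial.monomial 1 (ofV Δ 0 0 v) :=
  DeformedSmash.lift_ofV v

theorem gradingHom_word (l : List (V ⊕ A)) : gradingHom Δ (word Δ 0 0 l) =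
    Polynomial.monomial (wordDeg l) (word Δ 0 0 l) := by
  induction l with
  | nil => simp
  | cons x l ih =>
    rw [word_cons, wordDeg_cons, map_mul, ih, ← Polynomial.monomial_mul_monomial]
    cases x <;> simp [Polynomial.monomial_mul_monomial]

theorem gradingHom_of_mem {n : ℕ} {b : SmashSym V Δ} (hb : b ∈ grading V Δ n) :
    gradingHom Δ b = Polynomial.monomial n b := by
  induction hb using Submodule.span_induction with
  | mem x h =>
    obtain ⟨l, rfl, rfl⟩ := h
    exact gradingHom_word Δ l
  | zero => simp
  | add x y _ _ hx hy => rw [map_add, map_add, hx, hy]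
  | smul r x _ hx => rw [map_smul, hx, Polynomial.smul_monomial]

/-- The coefficients of `gradingHom Δ b` serve as the homogeneous components of `b`; by
`eval_one_gradingHom` they sum to `b`. -/
theorem coeff_gradingHom_mem (n : ℕ) (b : SmashSym V Δ) :
    (gradingHom Δ b).coeff n ∈ grading V Δ n := by
  have hb : b ∈ Submodule.span k (Set.range (word Δ 0 0)) := by simp [span_range_word]
  induction hb using Submodule.span_induction with
  | mem x h =>
    obtain ⟨l, rfl⟩ := h
    rw [gradingHom_word, Polynomial.coeff_monomial]
    split_ifs with h
    · exact h ▸ word_mem_grading Δ l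
    · exact zero_mem _
  | zero => simp
  | add x y _ _ hx hy => rw [map_add, Polynomial.coeff_add]; exact add_mem hx hy
  | smul r x _ hx => rw [map_smul, Polynomial.coeff_smul]; exact Submodule.smul_mem _ _ hx

theorem eval_one_gradingHom (b : SmashSym V Δ) : (gradingHom Δ b).eval 1 = b := by
  have : ((Polynomial.leval 1).restrictScalars k) ∘ₗ (gradingHom Δ).toLinearMap =
      (LinearMap.id : SmashSym V Δ →ₗ[k] _) := by
    apply linearMap_ext_word
    intro l
    simp [gradingHom_word]
  exact LinearMap.congr_fun this b

theorem gradingHom_injective : Function.Injective (gradingHom (V := V) Δ) := fun b c h => by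
  rw [← eval_one_gradingHom Δ b, h, eval_one_gradingHom]

/-- The coefficient of `Xⁿ` in `gradingHom` is `b` itself on degree `n`, and zero on words of
smaller degree. -/
theorem eq_zero_of_mem_grading_of_mem_filtLT {n : ℕ} {b : SmashSym V Δ} (hb : b ∈ grading V Δ n)
    (hb' : b ∈ filtLT Δ 0 0 n) : b = 0 := by
  have h : (gradingHom Δ b).coeff n = 0 := by
    clear hb
    induction hb' using Submodule.span_induction with
    | mem x h =>
      obtain ⟨l, hl, rfl⟩ := h
      rw [gradingHom_word, Polynomial.coeff_monomial, if_neg hl.ne]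
    | zero => simp
    | add x y _ _ hx hy => rw [map_add, Polynomial.coeff_add, hx, hy, add_zero]
    | smul r x _ hx => rw [map_smul, Polynomial.coeff_smul, hx, smul_zero]
  rwa [gradingHom_of_mem Δ hb, Polynomial.coeff_monomial, if_pos rfl] at h

end Basics

/-! ### The Rees algebra and the canonical surjection -/

section Rees

variable {k : Type u} {A : Type v} {V : Type w}
  [CommRing k] [Ring A] [Algebra k A] [AddCommGroup V] [Module k V] [Module A V]
  [IsScalarTower k A V]
  (Δ : CocommutativeCoproduct k A) (lam : A →ₗ[k] V →ₗ[k] A) (κ : V [⋀^Fin 2]→ₗ[k] (V × A))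

/-- The Rees algebra `⨁ F_n X ^ n ⊆ ℋ[X]` of the filtration of `ℋ_{λ,κ}`. -/
def rees : Subalgebra k (DeformedSmash Δ lam κ)[X] where
  carrier := {p | ∀ n, p.coeff n ∈ filt Δ lam κ n}
  mul_mem' {p q} hp hq n := by
    rw [Polynomial.coeff_mul]
    refine sum_mem fun i hi => ?_
    obtain rfl : i.1 + i.2 = n := by simpa using hi
    exact filt_mul_mem Δ lam κ (hp _) (hq _)
  add_mem' hp hq n := by
    rw [Polynomial.coeff_add]
    exact add_mem (hp n) (hq n)
  algebraMap_mem' r n := by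
    rw [Polynomial.algebraMap_apply, Polynomial.coeff_C]
    split_ifs with h
    · rw [h, Algebra.algebraMap_eq_smul_one]
      exact Submodule.smul_mem _ _ (one_mem_filt Δ lam κ)
    · exact zero_mem _

theorem monomial_mem_rees {n : ℕ} {x : DeformedSmash Δ lam κ} (hx : x ∈ filt Δ lam κ n) :
    Polynomial.monomial n x ∈ rees Δ lam κ := fun m => by
  rw [Polynomial.coeff_monomial]
  split_ifs with h
  · exact h ▸ hx
  · exact zero_mem _

/-- The ideal `⨁ F_{n-1} X ^ n` of the Rees algebra. The quotient is the associated graded algebra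
of `ℋ_{λ,κ}`. -/
def reesIdeal : Ideal (rees Δ lam κ) where
  carrier := {p | ∀ n, p.1.coeff n ∈ filtLT Δ lam κ n}
  add_mem' hp hq n := by
    simpa using add_mem (hp n) (hq n)
  zero_mem' n := by simp
  smul_mem' p q hq n := by
    change (p.1 * q.1).coeff n ∈ _
    rw [Polynomial.coeff_mul]
    refine sum_mem fun i hi => ?_
    obtain rfl : i.1 + i.2 = n := by simpa using hi
    exact filt_mul_filtLT_mem Δ lam κ (p.2 _) (hq _)

instance : (reesIdeal Δ lam κ).IsTwoSided where
  mul_mem_of_left {p} q hp n := by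
    change (p.1 * q.1).coeff n ∈ _
    rw [Polynomial.coeff_mul]
    refine sum_mem fun i hi => ?_
    obtain rfl : i.1 + i.2 = n := by simpa using hi
    exact filtLT_mul_filt_mem Δ lam κ (hp _) (q.2 _)

theorem monomial_mem_reesIdeal {n : ℕ} {x : DeformedSmash Δ lam κ} (hx : x ∈ filtLT Δ lam κ n) :
    (⟨Polynomial.monomial n x, monomial_mem_rees Δ lam κ (filtLT_le_filt Δ lam κ n hx)⟩ :
      rees Δ lam κ) ∈ reesIdeal Δ lam κ := fun m => by
  change (Polynomial.monomial n x).coeff m ∈ _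
  rw [Polynomial.coeff_monomial]
  split_ifs with h
  · exact h ▸ hx
  · exact zero_mem _

/-- The generators `v X` of the Rees algebra. -/
def reesV : V →ₗ[k] rees Δ lam κ :=
  LinearMap.codRestrict (Subalgebra.toSubmodule (rees Δ lam κ))
    (((Polynomial.monomial 1).restrictScalars k) ∘ₗ ofV Δ lam κ)
    fun v => monomial_mem_rees Δ lam κ (ofV_mem_filt Δ lam κ v)

/-- The generators `a` of the Rees algebra. -/
def reesA : A →ₗ[k] rees Δ lam κ :=
  LinearMap.codRestrict (Subalgebra.toSubmodule (rees Δ lam κ))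
    (((Polynomial.monomial 0).restrictScalars k) ∘ₗ ofA Δ lam κ)
    fun a => monomial_mem_rees Δ lam κ (ofA_mem_filt Δ lam κ a)

theorem coe_reesV (v : V) :
    (reesV Δ lam κ v : (DeformedSmash Δ lam κ)[X]) = Polynomial.monomial 1 (ofV Δ lam κ v) := rfl

theorem coe_reesA (a : A) :
    (reesA Δ lam κ a : (DeformedSmash Δ lam κ)[X]) = Polynomial.monomial 0 (ofA Δ lam κ a) := rfl

/-- The left side has degree one, yet `λ(a, v)` lies in `F_0`: its monomial is in `reesIdeal`, so
the undeformed relation holds in the associated graded algebra. The same works for `κ`, with `F_1`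
in degree two. -/
theorem reesA_mul_reesV (a : A) (v : V) :
    ((reesA Δ lam κ a * reesV Δ lam κ v -
      sweedlerSum ((LinearMap.mul k _).compl₁₂ (reesV Δ lam κ) (reesA Δ lam κ)) v (Δ.comul a) :
        rees Δ lam κ) : (DeformedSmash Δ lam κ)[X]) =
      Polynomial.monomial 1 (ofA Δ lam κ (lam a v)) := by
  have hs := map_sweedlerSum ((Polynomial.monomial (R := DeformedSmash Δ lam κ) 1).restrictScalars k)
    ((LinearMap.mul k _).compl₁₂ (ofV Δ lam κ) (ofA Δ lam κ)) v (Δ.comul a)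
  rw [← ofA_mul_ofV, map_sub, AddSubgroupClass.coe_sub, MulMemClass.coe_mul, coe_reesA, coe_reesV,
    Polynomial.monomial_mul_monomial, zero_add]
  congr 1
  refine (map_sweedlerSum (rees Δ lam κ).val.toLinearMap _ _ _).trans (Eq.trans ?_ hs.symm)
  congr 2
  refine LinearMap.ext₂ fun v a => ?_
  simp [coe_reesA, coe_reesV]

theorem reesV_mul_reesV (v v' : V) :
    ((reesV Δ lam κ v * reesV Δ lam κ v' - reesV Δ lam κ v' * reesV Δ lam κ v : rees Δ lam κ) :
        (DeformedSmash Δ lam κ)[X]) =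
      Polynomial.monomial 2 (ofV Δ lam κ (kappaV κ v v') + ofA Δ lam κ (kappaA κ v v')) := by
  rw [← ofV_mul_ofV, map_sub, AddSubgroupClass.coe_sub, MulMemClass.coe_mul, MulMemClass.coe_mul,
    coe_reesV, coe_reesV, Polynomial.monomial_mul_monomial, Polynomial.monomial_mul_monomial]

/-- The canonical surjection from `Sym(V) ⋊ A` to the associated graded algebra of `ℋ_{λ,κ}`. -/
def toGr : SmashSym V Δ →ₐ[k] rees Δ lam κ ⧸ reesIdeal Δ lam κ :=
  DeformedSmash.lift ((Ideal.Quotient.mkₐ k _).toLinearMap ∘ₗ reesA Δ lam κ)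
    ((Ideal.Quotient.mkₐ k _).toLinearMap ∘ₗ reesV Δ lam κ)
    (by
      have : reesA Δ lam κ 1 = 1 := Subtype.ext (by simp [coe_reesA, ofA_one])
      simp [this])
    (fun a b => by
      have : reesA Δ lam κ a * reesA Δ lam κ b = reesA Δ lam κ (a * b) :=
        Subtype.ext (by simp [coe_reesA, ← ofA_mul])
      simp [← this])
    (fun a v => by
      have h := reesA_mul_reesV Δ lam κ a v
      have h2 : reesA Δ lam κ a * reesV Δ lam κ v -
          sweedlerSum ((LinearMap.mul k _).compl₁₂ (reesV Δ lam κ) (reesA Δ lam κ)) v (Δ.comul a) ∈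
          reesIdeal Δ lam κ := by
        convert monomial_mem_reesIdeal Δ lam κ (n := 1)
          (filtLT_succ Δ lam κ 0 ▸ ofA_mem_filt Δ lam κ (lam a v))
      rw [← Ideal.Quotient.eq_zero_iff_mem, map_sub, map_mul] at h2
      simp only [LinearMap.zero_apply, map_zero]
      refine Eq.trans ?_ h2
      congr 1
      refine Eq.trans ?_ (map_sweedlerSum
        (Ideal.Quotient.mkₐ k (reesIdeal Δ lam κ)).toLinearMap _ _ _).symm
      congr 2)
    (fun v v' => by
      have h := reesV_mul_reesV Δ lam κ v v'
      have h2 : reesV Δ lam κ v * reesV Δ lam κ v' - reesV Δ lam κ v' * reesV Δ lam κ v ∈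
          reesIdeal Δ lam κ := by
        convert monomial_mem_reesIdeal Δ lam κ (n := 2) (filtLT_succ Δ lam κ 1 ▸
          add_mem (ofV_mem_filt Δ lam κ (kappaV κ v v'))
            (filt_mono Δ lam κ zero_le_one (ofA_mem_filt Δ lam κ (kappaA κ v v'))))
      rw [← Ideal.Quotient.eq_zero_iff_mem, map_sub, map_mul, map_mul] at h2
      simpa using h2)

theorem toGr_ofA (a : A) :
    toGr Δ lam κ (ofA Δ 0 0 a) = Ideal.Quotient.mk _ (reesA Δ lam κ a) :=
  DeformedSmash.lift_ofA a

theorem toGr_ofV (v : V) :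
    toGr Δ lam κ (ofV Δ 0 0 v) = Ideal.Quotient.mk _ (reesV Δ lam κ v) :=
  DeformedSmash.lift_ofV v

theorem toGr_word (l : List (V ⊕ A)) :
    toGr Δ lam κ (word Δ 0 0 l) = Ideal.Quotient.mk _ (⟨Polynomial.monomial (wordDeg l)
      (word Δ lam κ l), monomial_mem_rees Δ lam κ (word_mem_filt Δ lam κ l)⟩ : rees Δ lam κ) := by
  induction l with
  | nil =>
    rw [word_nil, map_one, ← map_one (Ideal.Quotient.mk _)]
    congr 1
  | cons x l ih =>
    rw [word_cons, map_mul, ih]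
    cases x with
    | inl v =>
      rw [Sum.elim_inl, toGr_ofV, ← map_mul]
      congr 1
      exact Subtype.ext (by simp [coe_reesV, Polynomial.monomial_mul_monomial, word_cons,
        wordDeg_cons _ l])
    | inr a =>
      rw [Sum.elim_inr, toGr_ofA, ← map_mul]
      congr 1
      exact Subtype.ext (by simp [coe_reesA, word_cons, wordDeg_cons _ l])

/-- The projection of the associated graded algebra to its `n`-th component. -/
def grComponent (n : ℕ) : (rees Δ lam κ ⧸ reesIdeal Δ lam κ) →ₗ[k] GrPiece Δ lam κ n :=
  ((reesIdeal Δ lam κ).restrictScalars k).liftQ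
    (((filtLT Δ lam κ n).submoduleOf (filt Δ lam κ n)).mkQ ∘ₗ
      LinearMap.codRestrict (filt Δ lam κ n)
        (((Polynomial.lcoeff _ n).restrictScalars k) ∘ₗ (rees Δ lam κ).val.toLinearMap)
        fun p => p.2 n)
    (fun p hp => by
      rw [LinearMap.mem_ker, LinearMap.comp_apply, Submodule.mkQ_apply,
        Submodule.Quotient.mk_eq_zero]
      exact hp n) ∘ₗ
  (Submodule.Quotient.restrictScalarsEquiv k (reesIdeal Δ lam κ)).symm.toLinearMap

theorem grComponent_mk (n : ℕ) (p : rees Δ lam κ) :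
    grComponent Δ lam κ n (Ideal.Quotient.mk _ p) =
      Submodule.Quotient.mk ⟨p.1.coeff n, p.2 n⟩ := rfl

/-- The `n`-th component of the canonical surjection. -/
def canonicalMap (n : ℕ) : grading V Δ n →ₗ[k] GrPiece Δ lam κ n :=
  grComponent Δ lam κ n ∘ₗ (toGr Δ lam κ).toLinearMap ∘ₗ (grading V Δ n).subtype

theorem canonicalMap_word (l : List (V ⊕ A)) :
    canonicalMap Δ lam κ (wordDeg l) ⟨word Δ 0 0 l, word_mem_grading Δ l⟩ =
      Submodule.Quotient.mk ⟨word Δ lam κ l, word_mem_filt Δ lam κ l⟩ := by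
  change grComponent Δ lam κ (wordDeg l) (toGr Δ lam κ (word Δ 0 0 l)) = _
  rw [toGr_word, grComponent_mk]
  congr 2
  simp

/-- Words of degree below `n` vanish in `F_n / F_{n-1}`, and those of degree `n` are images of the
same words of `B`. -/
theorem canonicalMap_surjective (n : ℕ) : Function.Surjective (canonicalMap Δ lam κ n) := by
  have key (h : DeformedSmash Δ lam κ) (hh : h ∈ filt Δ lam κ n) :
      ∃ b, canonicalMap Δ lam κ n b = Submodule.Quotient.mk ⟨h, hh⟩ := by
    induction hh using Submodule.span_induction with
    | mem x hx =>
      obtain ⟨l, hl, rfl⟩ := hx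
      rcases hl.lt_or_eq with hl | rfl
      · refine ⟨0, ?_⟩
        rw [map_zero, eq_comm, Submodule.Quotient.mk_eq_zero]
        exact Submodule.subset_span ⟨l, hl, rfl⟩
      · exact ⟨_, canonicalMap_word Δ lam κ l⟩
    | zero => exact ⟨0, map_zero _⟩
    | add x y _ _ hx hy =>
      obtain ⟨b, hb⟩ := hx
      obtain ⟨c, hc⟩ := hy
      exact ⟨b + c, by rw [map_add, hb, hc]; rfl⟩
    | smul r x _ hx =>
      obtain ⟨b, hb⟩ := hx
      exact ⟨r • b, by rw [map_smul, hb]; rfl⟩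
  intro x
  obtain ⟨⟨h, hh⟩, rfl⟩ := Submodule.Quotient.mk_surjective _ x
  exact key h hh

/-- The PBW property holds as soon as the canonical surjection is injective. -/
theorem hasPBW_iff : HasPBW Δ lam κ ↔ ∀ n, Function.Injective (canonicalMap Δ lam κ n) := by
  refine ⟨fun ⟨φ, hφ⟩ n => ?_, fun h => ⟨fun n => LinearEquiv.ofBijective _
    ⟨h n, canonicalMap_surjective Δ lam κ n⟩, canonicalMap_word Δ lam κ⟩⟩
  have : canonicalMap Δ lam κ n = (φ n).toLinearMap := by
    ext ⟨b, hb⟩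
    induction hb using Submodule.span_induction with
    | mem x hx =>
      obtain ⟨l, rfl, rfl⟩ := hx
      exact (canonicalMap_word Δ lam κ l).trans (hφ l).symm
    | zero => exact (map_zero _).trans (map_zero (φ n)).symm
    | add x y hx hy hx' hy' =>
      exact (map_add (canonicalMap Δ lam κ n) ⟨x, hx⟩ ⟨y, hy⟩).trans
        ((congrArg₂ _ hx' hy').trans (map_add (φ n) ⟨x, hx⟩ ⟨y, hy⟩).symm)
    | smul r x hx hx' =>
      exact (map_smul (canonicalMap Δ lam κ n) r ⟨x, hx⟩).trans
        ((congrArg _ hx').trans (map_smul (φ n) r ⟨x, hx⟩).symm)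
  rw [this]
  exact (φ n).injective

end Rees

/-! ### Deformations over `k[t]` and their specialization -/

namespace Deformation

variable {k : Type u} {B : Type v} [Field k] [Ring B] [Algebra k B] (D : Deformation k B)

theorem equiv_X_pow_smul (n : ℕ) (x : D.carrier) :
    D.equiv ((Polynomial.X ^ n : k[X]) • x) = Polynomial.X ^ n * D.equiv x := by
  induction n with
  | zero => simp
  | succ n ih => rw [pow_succ', mul_smul, D.equiv_t, ih, pow_succ', mul_assoc]

@[simp]
theorem equiv_incl (b : B) : D.equiv (D.incl b) = Polynomial.C b := by simp [incl]

theorem coeff_equiv_incl_mul_incl (j : ℕ) (b c : B) :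
    (D.equiv (D.incl b * D.incl c)).coeff j = D.mu j b c := rfl

@[simp]
theorem mu_zero (b c : B) : D.mu 0 b c = b * c := by
  rw [← coeff_equiv_incl_mul_incl, D.coeff_zero_mul]
  simp

theorem equiv_symm_monomial (n : ℕ) (b : B) :
    D.equiv.symm (Polynomial.monomial n b) = (Polynomial.X ^ n : k[X]) • D.incl b := by
  rw [LinearEquiv.symm_apply_eq, equiv_X_pow_smul, equiv_incl, Polynomial.X_pow_mul_C,
    Polynomial.C_mul_X_pow_eq_monomial]

/-! ### The specialization at `t = 1` -/

theorem mkAtOne_X_smul (x : D.carrier) : D.mkAtOne ((Polynomial.X : k[X]) • x) = D.mkAtOne x := by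
  have h : D.mkAtOne (algebraMap k[X] D.carrier Polynomial.X) = D.mkAtOne 1 :=
    RingQuot.mkAlgHom_rel k ⟨rfl, rfl⟩
  rw [Algebra.smul_def, map_mul, h, map_one, one_mul]

/-- Since `t` becomes `1`, each `b tⁿ` has the class of `b`. -/
theorem mkAtOne_eq (x : D.carrier) : D.mkAtOne x = D.toAtOne ((D.equiv x).eval 1) := by
  obtain ⟨p, rfl⟩ := D.equiv.symm.surjective x
  rw [LinearEquiv.apply_symm_apply]
  induction p using Polynomial.induction_on' with
  | add p q hp hq => rw [map_add, map_add, hp, hq, Polynomial.eval_add, map_add]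
  | monomial n b =>
    rw [equiv_symm_monomial, Polynomial.eval_monomial, one_pow, mul_one]
    induction n with
    | zero => simp [toAtOne]
    | succ n ih => rw [pow_succ', mul_smul, mkAtOne_X_smul, ih]

theorem toAtOne_surjective : Function.Surjective D.toAtOne := fun x => by
  obtain ⟨y, rfl⟩ : ∃ y, D.mkAtOne y = x := RingQuot.mkAlgHom_surjective k _ x
  exact ⟨_, (D.mkAtOne_eq y).symm⟩

theorem toAtOne_injective : Function.Injective D.toAtOne := by
  rw [injective_iff_map_eq_zero]
  intro b hb
  let I : Ideal D.carrier := Ideal.span {algebraMap k[X] D.carrier Polynomial.X - 1}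
  -- The left ideal generated by `t - 1` is two-sided because `t` is central.
  have hI : I.IsTwoSided := ⟨fun {x} y hx => by
    obtain ⟨z, rfl⟩ := Ideal.mem_span_singleton'.mp hx
    refine Ideal.mem_span_singleton'.mpr ⟨z * y, ?_⟩
    rw [mul_assoc, mul_assoc, mul_sub, sub_mul, Algebra.commutes, mul_one, one_mul]⟩
  let g : D.AtOne →ₐ[k] D.carrier ⧸ I := RingQuot.liftAlgHom k ⟨Ideal.Quotient.mkₐ k I, by
    rintro x y ⟨rfl, rfl⟩
    exact Ideal.Quotient.eq.mpr (Ideal.subset_span rfl)⟩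
  have hg : g (D.toAtOne b) = Ideal.Quotient.mk I (D.incl b) :=
    RingQuot.liftAlgHom_mkAlgHom_apply k _ _ _
  rw [hb, map_zero, eq_comm, Ideal.Quotient.eq_zero_iff_mem] at hg
  obtain ⟨z, hz⟩ := Ideal.mem_span_singleton'.mp hg
  rw [mul_sub, mul_one, ← Algebra.commutes, ← Algebra.smul_def] at hz
  -- Evaluation at `t = 1` kills `t z - z` and returns `b` on `incl b`.
  have := congrArg (fun x => (D.equiv x).eval 1) hz
  simpa [D.equiv_t, Polynomial.X_mul (p := D.equiv z)] using this.symm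

theorem toAtOne_mul_toAtOne (b c : B) :
    D.toAtOne b * D.toAtOne c = D.toAtOne ((D.equiv (D.incl b * D.incl c)).eval 1) := by
  rw [← mkAtOne_eq, map_mul]
  rfl

/-- The unit of `B` is the unit of `B_t` if it is idempotent there. -/
theorem incl_one_of_mul_self (h : D.incl 1 * D.incl 1 = D.incl 1) : D.incl 1 = 1 := by
  -- The idempotent `f` has zero constant coefficient, hence is divisible by `t`; as `f = f * f`, it
  -- is divisible by every power of `t`, so all its coefficients vanish.
  set f : D.carrier := 1 - D.incl 1 with hf
  have hff : f * f = f := by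
    rw [hf, sub_mul, mul_sub, mul_sub, one_mul, one_mul, mul_one, h, sub_self, sub_zero]
  have h1 : ∃ g : D.carrier, f = (Polynomial.X : k[X]) • g := by
    refine ⟨D.equiv.symm (D.equiv f).divX, D.equiv.injective ?_⟩
    rw [D.equiv_t, LinearEquiv.apply_symm_apply]
    have h0 : (D.equiv f).coeff 0 = 0 := by simp [hf, D.coeff_zero_one]
    conv_lhs => rw [← Polynomial.X_mul_divX_add (D.equiv f), h0]
    simp
  have hn (n : ℕ) : ∃ g : D.carrier, f = (Polynomial.X ^ n : k[X]) • g := by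
    induction n with
    | zero => exact ⟨f, by simp⟩
    | succ n ih =>
      obtain ⟨g, hg⟩ := ih
      obtain ⟨g', hg'⟩ := h1
      refine ⟨g * g', ?_⟩
      rw [pow_succ, ← smul_mul_smul_comm, ← hg, ← hg', hff]
  have hf0 : f = 0 := by
    apply D.equiv.injective
    ext n
    obtain ⟨g, hg⟩ := hn (n + 1)
    rw [hg, equiv_X_pow_smul, Polynomial.coeff_X_pow_mul', if_neg (by omega)]
    simp
  exact (sub_eq_zero.mp hf0).symm

variable {D} {𝒢 : ℕ → Submodule k B}

/-- Homogeneity kills `μ_j` for `j > m + n`, so the value at `t = 1` is a sum over a range fixed by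
the degrees. -/
theorem IsGraded.equiv_incl_mul_incl (hD : D.IsGraded 𝒢) {m n : ℕ} {b c : B} (hb : b ∈ 𝒢 m)
    (hc : c ∈ 𝒢 n) : (D.equiv (D.incl b * D.incl c)).eval 1 =
      b * c + ∑ j ∈ Finset.range (m + n), D.mu (j + 1) b c := by
  rw [Polynomial.eval_eq_sum_range' (n := m + n + 1), Finset.sum_range_succ']
  · simp [coeff_equiv_incl_mul_incl, add_comm]
  · rw [Nat.lt_succ_iff, Polynomial.natDegree_le_iff_coeff_eq_zero]
    exact fun j hj => (hD j m n b hb c hc).2 hj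

/-- For `j > 0` the element `μ_j(1 ⊗ 1)` would have negative degree, so `1 * 1 = 1` in `B_t`. -/
theorem IsGraded.incl_one (hD : D.IsGraded 𝒢) (h1 : (1 : B) ∈ 𝒢 0) : D.incl 1 = 1 := by
  apply incl_one_of_mul_self
  apply D.equiv.injective
  ext j
  rw [coeff_equiv_incl_mul_incl, equiv_incl, Polynomial.coeff_C]
  split_ifs with h
  · subst h
    simp
  · exact (hD j 0 0 1 h1 1 h1).2 (by omega)

theorem IsGraded.toAtOne_mul_toAtOne (hD : D.IsGraded 𝒢) {m n : ℕ} {b c : B} (hb : b ∈ 𝒢 m)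
    (hc : c ∈ 𝒢 n) : D.toAtOne b * D.toAtOne c =
      D.toAtOne (b * c + ∑ j ∈ Finset.range (m + n), D.mu (j + 1) b c) := by
  rw [Deformation.toAtOne_mul_toAtOne, hD.equiv_incl_mul_incl hb hc]

end Deformation

/-! ### The homomorphism from `ℋ_{λ,κ}` to the specialization -/

section AtOne

variable {k : Type u} {A : Type v} {V : Type w} [Field k] [Ring A] [Algebra k A] [AddCommGroup V]
  [Module k V] [Module A V] [IsScalarTower k A V]
  {Δ : CocommutativeCoproduct k A} {lam : A →ₗ[k] V →ₗ[k] A} {κ : V [⋀^Fin 2]→ₗ[k] (V × A)}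
  {D : Deformation k (SmashSym V Δ)}

theorem sweedlerSum_add {M : Type*} [AddCommGroup M] [Module k M] (β γ : V →ₗ[k] A →ₗ[k] M) (v : V)
    (x : A ⊗[k] A) : sweedlerSum (β + γ) v x = sweedlerSum β v x + sweedlerSum γ v x := by
  induction x using TensorProduct.induction_on with
  | zero => simp
  | tmul a b => simp
  | add x y hx hy => rw [map_add, map_add, map_add, hx, hy]; abel

/-- The homomorphism from `ℋ_{λ,κ}` to the specialization at `t = 1` of a graded deformation that
recovers `λ` and `κ`. -/
def toSpecialization (hD : D.IsGraded (grading V Δ)) (hR : Recovers Δ lam κ D) :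
    DeformedSmash Δ lam κ →ₐ[k] D.AtOne :=
  DeformedSmash.lift (D.toAtOne ∘ₗ ofA Δ 0 0) (D.toAtOne ∘ₗ ofV Δ 0 0)
    (by
      rw [LinearMap.comp_apply, ofA_one]
      change D.mkAtOne (D.incl 1) = 1
      rw [hD.incl_one (one_mem_grading Δ), map_one])
    (fun a b => by
      simp only [LinearMap.comp_apply]
      rw [hD.toAtOne_mul_toAtOne (ofA_mem_grading Δ a) (ofA_mem_grading Δ b), ofA_mul]
      simp)
    (fun a v => by
      -- The factors have total degree one, so only `μ₁` corrects the product of `B`.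
      have hs : sweedlerSum ((LinearMap.mul k D.AtOne).compl₁₂ (D.toAtOne ∘ₗ ofV Δ 0 0)
          (D.toAtOne ∘ₗ ofA Δ 0 0)) v (Δ.comul a) = D.toAtOne
          (sweedlerSum ((LinearMap.mul k _).compl₁₂ (ofV Δ 0 0) (ofA Δ 0 0)) v (Δ.comul a) +
            sweedlerSum ((D.mu 1).compl₁₂ (ofV Δ 0 0) (ofA Δ 0 0)) v (Δ.comul a)) := by
        rw [← sweedlerSum_add, map_sweedlerSum]
        congr 2
        refine LinearMap.ext₂ fun v a => ?_
        simp [hD.toAtOne_mul_toAtOne (ofV_mem_grading Δ v) (ofA_mem_grading Δ a)]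
      rw [hs]
      simp only [LinearMap.comp_apply]
      rw [hD.toAtOne_mul_toAtOne (ofA_mem_grading Δ a) (ofV_mem_grading Δ v), ← map_sub, hR.lam_eq,
        add_sub_add_comm, ofA_mul_ofV]
      simp)
    (fun v v' => by
      simp only [LinearMap.comp_apply]
      have h := ofV_mul_ofV Δ 0 0 v v'
      simp only [kappaV_zero, kappaA_zero, map_zero, add_zero] at h
      -- The total degree is two: antisymmetrizing, `μ₁` contributes `κ_V` and `μ₂` contributes
      -- `κ_A`.
      rw [hD.toAtOne_mul_toAtOne (ofV_mem_grading Δ v) (ofV_mem_grading Δ v'),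
        hD.toAtOne_mul_toAtOne (ofV_mem_grading Δ v') (ofV_mem_grading Δ v), ← map_sub, ← map_add,
        hR.kappaV_eq, hR.kappaA_eq, add_sub_add_comm, h, Finset.sum_range_succ,
        Finset.sum_range_succ, Finset.sum_range_succ, Finset.sum_range_succ]
      simp [add_sub_add_comm])

/-- The difference is a sum of `μ_j(b, c)` with `j ≥ 1`, each of degree `m + n - j`. -/
theorem toAtOne_mul_toAtOne_sub_mem (hD : D.IsGraded (grading V Δ)) {m n : ℕ} {b c : SmashSym V Δ} (hb : b ∈ grading V Δ m)
    (hc : c ∈ grading V Δ n) : D.toAtOne b * D.toAtOne c - D.toAtOne (b * c) ∈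
      (filtLT Δ 0 0 (m + n)).map D.toAtOne := by
  rw [hD.toAtOne_mul_toAtOne hb hc, ← map_sub, add_sub_cancel_left]
  refine Submodule.mem_map_of_mem (sum_mem fun j hj => ?_)
  rw [Finset.mem_range] at hj
  exact grading_le_filtLT Δ (by omega : m + n - (j + 1) < m + n)
    ((hD (j + 1) m n b hb c hc).1 _ (by omega))

variable (hD : D.IsGraded (grading V Δ)) (hR : Recovers Δ lam κ D)

theorem toSpecialization_ofA (a : A) :
    toSpecialization hD hR (ofA Δ lam κ a) = D.toAtOne (ofA Δ 0 0 a) :=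
  DeformedSmash.lift_ofA a

theorem toSpecialization_ofV (v : V) :
    toSpecialization hD hR (ofV Δ lam κ v) = D.toAtOne (ofV Δ 0 0 v) :=
  DeformedSmash.lift_ofV v

end AtOne

/-! ### Triangularity: the PBW property and bijectivity -/

section Specialization

variable {k : Type u} {A : Type v} {V : Type w} [Field k] [Ring A] [Algebra k A] [AddCommGroup V]
  [Module k V] [Module A V] [IsScalarTower k A V]
  {Δ : CocommutativeCoproduct k A} {lam : A →ₗ[k] V →ₗ[k] A} {κ : V [⋀^Fin 2]→ₗ[k] (V × A)}
  {D : Deformation k (SmashSym V Δ)}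

theorem toAtOne_mul_mem (hD : D.IsGraded (grading V Δ)) {m n : ℕ} {b c : SmashSym V Δ}
    (hb : b ∈ grading V Δ m) (hc : c ∈ filtLT Δ 0 0 n) :
    D.toAtOne b * D.toAtOne c ∈ (filtLT Δ 0 0 (m + n)).map D.toAtOne := by
  induction hc using Submodule.span_induction with
  | mem x hx =>
    obtain ⟨l, hl, rfl⟩ := hx
    rw [← sub_add_cancel (D.toAtOne b * D.toAtOne (word Δ 0 0 l)) (D.toAtOne (b * word Δ 0 0 l))]
    refine add_mem ?_ (Submodule.mem_map_of_mem ?_)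
    · exact Submodule.map_mono (filtLT_mono Δ 0 0 (by omega))
        (toAtOne_mul_toAtOne_sub_mem hD hb (word_mem_grading Δ l))
    · exact filt_mul_filtLT_mem Δ 0 0
        ((filtLT_succ Δ 0 0 m).le (grading_le_filtLT Δ m.lt_succ_self hb))
        (grading_le_filtLT Δ hl (word_mem_grading Δ l))
  | zero => simp
  | add x y _ _ hx hy => rw [map_add, mul_add]; exact add_mem hx hy
  | smul r x _ hx => rw [map_smul, mul_smul_comm]; exact Submodule.smul_mem _ _ hx

variable (hD : D.IsGraded (grading V Δ)) (hR : Recovers Δ lam κ D)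

/-- In top degree, the map to the specialization sends each word to the same word of `B`. -/
theorem toSpecialization_word_sub_mem (l : List (V ⊕ A)) :
    toSpecialization hD hR (word Δ lam κ l) - D.toAtOne (word Δ 0 0 l) ∈
      (filtLT Δ 0 0 (wordDeg l)).map D.toAtOne := by
  induction l with
  | nil =>
    rw [word_nil, word_nil, ← ofA_one, ← ofA_one, toSpecialization_ofA, sub_self]
    exact zero_mem _
  | cons x l ih =>
    obtain ⟨b, hb, hb', hb''⟩ : ∃ b ∈ grading V Δ (wordDeg [x]),
        Sum.elim (ofV Δ 0 0) (ofA Δ 0 0) x = b ∧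
        toSpecialization hD hR (Sum.elim (ofV Δ lam κ) (ofA Δ lam κ) x) = D.toAtOne b := by
      cases x with
      | inl v => exact ⟨_, ofV_mem_grading Δ v, rfl, toSpecialization_ofV hD hR v⟩
      | inr a => exact ⟨_, ofA_mem_grading Δ a, rfl, toSpecialization_ofA hD hR a⟩
    obtain ⟨f, hf, hf'⟩ := ih
    -- With `w` the word of `l` in `B` and `f` the lower-degree error for `l`, the new error at `t =
    -- 1` is `b * f + (b * w - b w)`.
    rw [word_cons, word_cons, hb', wordDeg_cons, map_mul, hb'',
      ← sub_add_cancel (toSpecialization hD hR (word Δ lam κ l)) (D.toAtOne (word Δ 0 0 l)), ← hf',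
      mul_add, add_sub_assoc]
    exact add_mem (toAtOne_mul_mem hD hb hf)
      (toAtOne_mul_toAtOne_sub_mem hD hb (word_mem_grading Δ l))

/-- Linear extension of `toSpecialization_word_sub_mem`. A representative `h` of the image of `b` is
only asserted to exist, since words may be linearly dependent. -/
theorem exists_toSpecialization_sub_mem {n : ℕ} (b : grading V Δ n) :
    ∃ h : filt Δ lam κ n, canonicalMap Δ lam κ n b = Submodule.Quotient.mk h ∧
      toSpecialization hD hR h - D.toAtOne b ∈ (filtLT Δ 0 0 n).map D.toAtOne := by
  obtain ⟨b, hb⟩ := b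
  induction hb using Submodule.span_induction with
  | mem x hx =>
    obtain ⟨l, rfl, rfl⟩ := hx
    exact ⟨_, canonicalMap_word Δ lam κ l, toSpecialization_word_sub_mem hD hR l⟩
  | zero => exact ⟨0, map_zero _, by simp⟩
  | add x y hx hy hx' hy' =>
    obtain ⟨h, h1, h2⟩ := hx'
    obtain ⟨h', h1', h2'⟩ := hy'
    refine ⟨h + h', ?_, ?_⟩
    · rw [Submodule.Quotient.mk_add, ← h1, ← h1']
      exact map_add (canonicalMap Δ lam κ n) ⟨x, hx⟩ ⟨y, hy⟩
    · simpa [add_sub_add_comm] using add_mem h2 h2'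
  | smul r x hx hx' =>
    obtain ⟨h, h1, h2⟩ := hx'
    refine ⟨r • h, ?_, ?_⟩
    · rw [Submodule.Quotient.mk_smul, ← h1]
      exact map_smul (canonicalMap Δ lam κ n) r ⟨x, hx⟩
    · simpa [smul_sub] using Submodule.smul_mem _ r h2

theorem toSpecialization_mem_map {n : ℕ} {h : DeformedSmash Δ lam κ}
    (hh : h ∈ filtLT Δ lam κ n) :
    toSpecialization hD hR h ∈ (filtLT Δ 0 0 n).map D.toAtOne := by
  induction hh using Submodule.span_induction with
  | mem x hx =>
    obtain ⟨l, hl, rfl⟩ := hx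
    rw [← sub_add_cancel (toSpecialization hD hR _) (D.toAtOne (word Δ 0 0 l))]
    exact add_mem (Submodule.map_mono (filtLT_mono Δ 0 0 hl.le)
      (toSpecialization_word_sub_mem hD hR l))
      (Submodule.mem_map_of_mem (grading_le_filtLT Δ hl (word_mem_grading Δ l)))
  | zero => simp
  | add x y _ _ hx hy => rw [map_add]; exact add_mem hx hy
  | smul r x _ hx => rw [map_smul]; exact Submodule.smul_mem _ _ hx

theorem eq_zero_of_toAtOne_mem_map {n : ℕ} {b : SmashSym V Δ} (hb : b ∈ grading V Δ n)
    (h : D.toAtOne b ∈ (filtLT Δ 0 0 n).map D.toAtOne) : b = 0 := by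
  obtain ⟨c, hc, hcb⟩ := h
  exact eq_zero_of_mem_grading_of_mem_filtLT Δ hb (D.toAtOne_injective hcb ▸ hc)


/-- A graded deformation of `Sym(V) ⋊ A` that recovers `λ` and `κ` forces the PBW property. -/
theorem hasPBW_of_recovers (hD : D.IsGraded (grading V Δ)) (hR : Recovers Δ lam κ D) :
    HasPBW Δ lam κ := by
  rw [hasPBW_iff]
  intro n
  rw [injective_iff_map_eq_zero]
  intro b hb
  obtain ⟨h, h1, h2⟩ := exists_toSpecialization_sub_mem hD hR b
  rw [hb, eq_comm, Submodule.Quotient.mk_eq_zero] at h1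
  have := sub_mem (toSpecialization_mem_map hD hR h1) h2
  simp only [Submodule.subtype_apply, sub_sub_cancel] at this
  exact Subtype.ext (eq_zero_of_toAtOne_mem_map b.2 this)

/-- A kernel element in `F_n` has a top part `b` in `B`, which triangularity forces to vanish; the
element then lies in `F_{n-1}`, and one descends to `F_{-1} = 0`. -/
theorem toSpecialization_injective : Function.Injective (toSpecialization hD hR) := by
  rw [injective_iff_map_eq_zero]
  intro x hx
  obtain ⟨n, hn⟩ := exists_mem_filtLT Δ lam κ x
  induction n with
  | zero => rwa [filtLT_zero, Submodule.mem_bot] at hn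
  | succ n ih =>
    rw [filtLT_succ] at hn
    refine ih ?_
    obtain ⟨b, hb⟩ := canonicalMap_surjective Δ lam κ n (Submodule.Quotient.mk ⟨x, hn⟩)
    obtain ⟨h, h1, h2⟩ := exists_toSpecialization_sub_mem hD hR b
    have hxh : x - h ∈ filtLT Δ lam κ n :=
      (Submodule.Quotient.eq ((filtLT Δ lam κ n).submoduleOf _)).mp (hb.symm.trans h1)
    have h3 := add_mem (toSpecialization_mem_map hD hR hxh) h2
    rw [map_sub, hx, zero_sub, neg_add_eq_sub, sub_sub_cancel_left, ← map_neg] at h3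
    have hb0 : b = 0 := Subtype.ext (neg_eq_zero.mp
      (eq_zero_of_toAtOne_mem_map (neg_mem b.2) h3))
    rw [hb0, map_zero, eq_comm, Submodule.Quotient.mk_eq_zero] at hb
    exact hb

/-- Each word of `B` is the image of the same word of `ℋ_{λ,κ}` minus an error of lower degree,
already in the range by induction. -/
theorem toSpecialization_surjective : Function.Surjective (toSpecialization hD hR) := by
  have key (n : ℕ) : (filtLT Δ 0 0 n).map D.toAtOne ≤
      LinearMap.range (toSpecialization hD hR).toLinearMap := by
    induction n with
    | zero => simp [filtLT_zero]
    | succ n ih =>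
      rw [filtLT, Submodule.map_span_le]
      rintro _ ⟨l, hl, rfl⟩
      rw [← sub_sub_cancel (toSpecialization hD hR (word Δ lam κ l)) (D.toAtOne (word Δ 0 0 l))]
      exact sub_mem ⟨_, rfl⟩ (ih (Submodule.map_mono (filtLT_mono Δ 0 0 (Nat.lt_succ_iff.mp hl))
        (toSpecialization_word_sub_mem hD hR l)))
  intro x
  obtain ⟨b, rfl⟩ := D.toAtOne_surjective x
  obtain ⟨n, hn⟩ := exists_mem_filtLT Δ 0 0 b
  exact key n (Submodule.mem_map_of_mem hn)

end Specialization

/-! ### Injectivity of `V → B` and filtered lifts -/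

section ReesDeformation

variable {k : Type u} {A : Type v} {V : Type w} [Field k] [Ring A] [Algebra k A] [AddCommGroup V]
  [Module k V] [Module A V] [IsScalarTower k A V]
  (Δ : CocommutativeCoproduct k A) (lam : A →ₗ[k] V →ₗ[k] A) (κ : V [⋀^Fin 2]→ₗ[k] (V × A))

/-- The action of `A` on `A ⊕ (V ⊗ A)`, diagonal on `V ⊗ A`. -/
def truncatedA : A →ₐ[k] Module.End k (A × (V ⊗[k] A)) :=
  (LinearMap.prodMapAlgHom k A (V ⊗[k] A)).comp ((Algebra.lmul k A).prod
    (((Module.endTensorEndAlgHom (R := k) (S := k) (A := k) (M := V) (N := A)).comp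
      (Algebra.TensorProduct.map (Algebra.lsmul k k V) (Algebra.lmul k A))).comp Δ.comul))

variable (k A V) in
/-- The action of `V` on `A ⊕ (V ⊗ A)`, which vanishes on `V ⊗ A`. -/
def truncatedV : V →ₗ[k] Module.End k (A × (V ⊗[k] A)) where
  toFun v := LinearMap.inr k A (V ⊗[k] A) ∘ₗ TensorProduct.mk k V A v ∘ₗ LinearMap.fst k A _
  map_add' v v' := by ext <;> simp
  map_smul' r v := by ext <;> simp

/-- The representation of `Sym(V) ⋊ A` on its truncation in degrees at most `1`. -/
def truncatedRep : SmashSym V Δ →ₐ[k] Module.End k (A × (V ⊗[k] A)) :=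
  DeformedSmash.lift (truncatedA Δ).toLinearMap (truncatedV k A V)
    (map_one (truncatedA Δ))
    (fun a b => (map_mul (truncatedA Δ) a b).symm)
    (fun a v => by
      -- On `(b, 0)` both sides of the action relation give `∑ a₍₁₎(v) ⊗ a₍₂₎ b` in `V ⊗ A`; on `(0,
      -- y)` both vanish.
      have key (x : A ⊗[k] A) (b : A) : sweedlerSum ((LinearMap.mul k _).compl₁₂
          (truncatedV k A V) (truncatedA Δ).toLinearMap) v x (b, 0) =
          (0, TensorProduct.map (LinearMap.id) (LinearMap.mulRight k b)
            (TensorProduct.map ((LinearMap.toSpanSingleton A V v).restrictScalars k)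
              LinearMap.id x)) := by
        induction x using TensorProduct.induction_on with
        | zero => simp [Prod.zero_eq_mk]
        | tmul a₁ a₂ => simp [truncatedA, truncatedV]
        | add x y hx hy => simp [hx, hy]
      have key' (x : A ⊗[k] A) (y : V ⊗[k] A) : sweedlerSum ((LinearMap.mul k _).compl₁₂
          (truncatedV k A V) (truncatedA Δ).toLinearMap) v x (0, y) = 0 := by
        induction x using TensorProduct.induction_on with
        | zero => simp
        | tmul a₁ a₂ => simp [truncatedA, truncatedV]
        | add x y hx hy => simp [hx, hy]
      have key'' (x : A ⊗[k] A) (b : A) : Module.endTensorEndAlgHom (R := k) (S := k) (A := k)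
          (M := V) (N := A) (Algebra.TensorProduct.map (Algebra.lsmul k k V) (Algebra.lmul k A) x)
          (v ⊗ₜ[k] b) = TensorProduct.map (LinearMap.id) (LinearMap.mulRight k b)
            (TensorProduct.map ((LinearMap.toSpanSingleton A V v).restrictScalars k)
              LinearMap.id x) := by
        induction x using TensorProduct.induction_on with
        | zero => simp
        | tmul a₁ a₂ => simp [Module.endTensorEndAlgHom_apply]
        | add x y hx hy => rw [map_add, map_add, map_add, map_add, LinearMap.add_apply, hx, hy]
      simp only [LinearMap.zero_apply, map_zero]
      rw [sub_eq_zero]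
      refine LinearMap.ext fun ⟨b, y⟩ => ?_
      rw [← add_zero b, ← zero_add y, ← Prod.mk_add_mk, map_add, map_add, key, key']
      simp [truncatedA, truncatedV, key''])
    (fun v v' => by
      simp only [kappaV_zero, kappaA_zero, map_zero, add_zero, sub_eq_zero]
      ext <;> simp [truncatedV])

/-- In the truncated representation `v` sends `1` to `v ⊗ 1`, from which `v` can be recovered. -/
theorem ofV_injective : Function.Injective (ofV (V := V) Δ 0 0) := by
  rw [injective_iff_map_eq_zero]
  intro v hv
  have h : truncatedRep Δ (ofV Δ 0 0 v) = truncatedV k A V v := DeformedSmash.lift_ofV v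
  rw [hv, map_zero] at h
  have h1 : v ⊗ₜ[k] (1 : A) = 0 := (congrArg Prod.snd (LinearMap.congr_fun h (1, 0))).symm
  rcases subsingleton_or_nontrivial A with _ | _
  · rw [← one_smul A v, Subsingleton.elim (1 : A) 0, zero_smul]
  -- A linear functional with `f 1 = 1` plays the part of a counit: `id ⊗ f` sends `v ⊗ 1` to `v`.
  · obtain ⟨f, hf⟩ := (LinearMap.toSpanSingleton k A 1).exists_leftInverse_of_injective
      (LinearMap.ker_toSpanSingleton k one_ne_zero)
    have hf1 : f 1 = 1 := by simpa using LinearMap.congr_fun hf 1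
    simpa [hf1] using congrArg (TensorProduct.rid k V ∘ f.lTensor V) h1

/-- Linear lifts `B → ℋ_{λ,κ}` of the components of the canonical surjection, normalized to be the
identity on `V`. -/
structure FilteredLift where
  lift : ℕ → SmashSym V Δ →ₗ[k] DeformedSmash Δ lam κ
  lift_mem : ∀ n, ∀ b ∈ grading V Δ n, lift n b ∈ filt Δ lam κ n
  mk_lift : ∀ n b (hb : b ∈ grading V Δ n),
    canonicalMap Δ lam κ n ⟨b, hb⟩ = Submodule.Quotient.mk ⟨lift n b, lift_mem n b hb⟩
  lift_ofV : ∀ v, lift 1 (ofV Δ 0 0 v) = ofV Δ lam κ v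

theorem mk_eq_mk_iff {n : ℕ} (x y : filt Δ lam κ n) :
    (Submodule.Quotient.mk x : GrPiece Δ lam κ n) = Submodule.Quotient.mk y ↔
      (x : DeformedSmash Δ lam κ) - y ∈ filtLT Δ lam κ n :=
  Submodule.Quotient.eq ((filtLT Δ lam κ n).submoduleOf _)

theorem canonicalMap_ofV (v : V) :
    canonicalMap Δ lam κ 1 ⟨ofV Δ 0 0 v, ofV_mem_grading Δ v⟩ =
      Submodule.Quotient.mk ⟨ofV Δ lam κ v, ofV_mem_filt Δ lam κ v⟩ := by
  have := canonicalMap_word Δ lam κ [Sum.inl v]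
  simp only [word_inl] at this
  exact this

theorem canonicalMap_ofA (a : A) :
    canonicalMap Δ lam κ 0 ⟨ofA Δ 0 0 a, ofA_mem_grading Δ a⟩ =
      Submodule.Quotient.mk ⟨ofA Δ lam κ a, ofA_mem_filt Δ lam κ a⟩ := by
  have := canonicalMap_word Δ lam κ [Sum.inr a]
  simp only [word_inr] at this
  exact this

/-- Over a field the quotients `F_n → F_n / F_{n-1}` split linearly. Only degree one then needs
adjusting to be exact on `V`. -/
instance : Nonempty (FilteredLift Δ lam κ) := by
  have h (n : ℕ) : ∃ T : SmashSym V Δ →ₗ[k] DeformedSmash Δ lam κ, ∀ b (hb : b ∈ grading V Δ n),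
      ∃ hT : T b ∈ filt Δ lam κ n,
        canonicalMap Δ lam κ n ⟨b, hb⟩ = Submodule.Quotient.mk ⟨T b, hT⟩ := by
    obtain ⟨σ, hσ⟩ := ((filtLT Δ lam κ n).submoduleOf
      (filt Δ lam κ n)).mkQ.exists_rightInverse_of_surjective (Submodule.range_mkQ _)
    obtain ⟨T, hT⟩ := LinearMap.exists_extend
      ((filt Δ lam κ n).subtype ∘ₗ σ ∘ₗ canonicalMap Δ lam κ n)
    refine ⟨T, fun b hb => ?_⟩
    have hTb : T b = σ (canonicalMap Δ lam κ n ⟨b, hb⟩) := LinearMap.congr_fun hT ⟨b, hb⟩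
    refine ⟨hTb ▸ Subtype.property _, ?_⟩
    refine (LinearMap.congr_fun hσ (canonicalMap Δ lam κ n ⟨b, hb⟩)).symm.trans ?_
    exact congrArg _ (Subtype.ext hTb.symm)
  choose T hT hT' using h
  obtain ⟨L, hL⟩ := (ofV (V := V) Δ 0 0).exists_leftInverse_of_injective
    (LinearMap.ker_eq_bot.mpr (ofV_injective Δ))
  have hL (v : V) : L (ofV Δ 0 0 v) = v := LinearMap.congr_fun hL v
  have hd (v : V) : T 1 (ofV Δ 0 0 v) - ofV Δ lam κ v ∈ filtLT Δ lam κ 1 :=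
    (mk_eq_mk_iff Δ lam κ ⟨_, hT 1 _ (ofV_mem_grading Δ v)⟩ ⟨_, ofV_mem_filt Δ lam κ v⟩).mp
      ((hT' 1 _ (ofV_mem_grading Δ v)).symm.trans (canonicalMap_ofV Δ lam κ v))
  -- The correction factors through a left inverse `L` of `V → B`, so it takes values in `F_0`
  -- everywhere and leaves classes modulo `F_0` unchanged.
  let T₁ := T 1 - (T 1 ∘ₗ ofV Δ 0 0 - ofV Δ lam κ) ∘ₗ L
  have hT₁ (b : SmashSym V Δ) : T 1 b - T₁ b ∈ filtLT Δ lam κ 1 := by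
    simpa [T₁] using hd (L b)
  have hmem (n : ℕ) (b) (hb : b ∈ grading V Δ n) :
      Function.update T 1 T₁ n b ∈ filt Δ lam κ n := by
    rcases eq_or_ne n 1 with rfl | hn
    · rw [Function.update_self, ← sub_sub_cancel (T 1 b) (T₁ b)]
      exact sub_mem (hT 1 b hb) (filtLT_le_filt Δ lam κ 1 (hT₁ b))
    · rw [Function.update_of_ne hn]
      exact hT n b hb
  refine ⟨⟨Function.update T 1 T₁, hmem, fun n b hb => ?_, fun v => ?_⟩⟩
  · rw [hT' n b hb, mk_eq_mk_iff]
    rcases eq_or_ne n 1 with rfl | hn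
    · simpa only [Function.update_self] using hT₁ b
    · simp only [Function.update_of_ne hn, sub_self, zero_mem]
  · simp [T₁, hL]

variable {Δ lam κ}

namespace FilteredLift

variable (S : FilteredLift Δ lam κ)

/-- No normalization is needed in degree zero, because `F_{-1} = 0`. -/
theorem lift_ofA (a : A) : S.lift 0 (ofA Δ 0 0 a) = ofA Δ lam κ a := by
  have h := (S.mk_lift 0 _ (ofA_mem_grading Δ a)).symm.trans (canonicalMap_ofA Δ lam κ a)
  rw [mk_eq_mk_iff, filtLT_zero] at h
  exact sub_eq_zero.mp h

theorem lift_word_sub_mem (l : List (V ⊕ A)) :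
    word Δ lam κ l - S.lift (wordDeg l) (word Δ 0 0 l) ∈ filtLT Δ lam κ (wordDeg l) := by
  have h := (canonicalMap_word Δ lam κ l).symm.trans (S.mk_lift _ _ (word_mem_grading Δ l))
  rwa [mk_eq_mk_iff] at h

/-- The lift `∑ b_n ↦ ∑ lift b_n X ^ n` of the canonical surjection to the Rees algebra. -/
def toRees : SmashSym V Δ →ₗ[k] rees Δ lam κ :=
  LinearMap.codRestrict (Subalgebra.toSubmodule (rees Δ lam κ))
    (Polynomial.lsum (fun n => ((Polynomial.monomial n).restrictScalars k) ∘ₗ S.lift n) ∘ₗ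
      (gradingHom Δ).toLinearMap)
    fun b => by
      rw [LinearMap.comp_apply, Polynomial.lsum_apply]
      exact sum_mem fun n _ =>
        monomial_mem_rees Δ lam κ (S.lift_mem n _ (coeff_gradingHom_mem Δ n b))

theorem coe_toRees {n : ℕ} {b : SmashSym V Δ} (hb : b ∈ grading V Δ n) :
    (S.toRees b : (DeformedSmash Δ lam κ)[X]) = Polynomial.monomial n (S.lift n b) := by
  change Polynomial.lsum _ (gradingHom Δ b) = _
  rw [gradingHom_of_mem Δ hb, Polynomial.lsum_apply, Polynomial.sum_monomial_index _ _ (by simp)]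
  rfl

theorem coeff_toRees (n : ℕ) (b : SmashSym V Δ) :
    (S.toRees b : (DeformedSmash Δ lam κ)[X]).coeff n = S.lift n ((gradingHom Δ b).coeff n) := by
  have : ((Polynomial.lcoeff _ n).restrictScalars k) ∘ₗ (rees Δ lam κ).val.toLinearMap ∘ₗ
      S.toRees = S.lift n ∘ₗ ((Polynomial.lcoeff _ n).restrictScalars k) ∘ₗ
        (gradingHom Δ).toLinearMap := by
    apply linearMap_ext_word
    intro l
    simp only [LinearMap.comp_apply, AlgHom.toLinearMap_apply, LinearMap.restrictScalars_apply,
      Polynomial.lcoeff_apply, Subalgebra.coe_val, S.coe_toRees (word_mem_grading Δ l),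
      gradingHom_word, Polynomial.coeff_monomial]
    split_ifs with h
    · rw [h]
    · rw [map_zero]
  exact LinearMap.congr_fun this b

theorem toRees_ofA (a : A) : S.toRees (ofA Δ 0 0 a) = reesA Δ lam κ a :=
  Subtype.ext (by rw [S.coe_toRees (ofA_mem_grading Δ a), S.lift_ofA, coe_reesA])

theorem toRees_ofV (v : V) : S.toRees (ofV Δ 0 0 v) = reesV Δ lam κ v :=
  Subtype.ext (by rw [S.coe_toRees (ofV_mem_grading Δ v), S.lift_ofV, coe_reesV])

theorem mk_toRees (b : SmashSym V Δ) : Ideal.Quotient.mk _ (S.toRees b) = toGr Δ lam κ b := by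
  have : (Ideal.Quotient.mkₐ k (reesIdeal Δ lam κ)).toLinearMap ∘ₗ S.toRees =
      (toGr Δ lam κ).toLinearMap := by
    apply linearMap_ext_word
    intro l
    simp only [LinearMap.comp_apply, AlgHom.toLinearMap_apply, Ideal.Quotient.mkₐ_eq_mk, toGr_word]
    rw [eq_comm, Ideal.Quotient.mk_eq_mk_iff_sub_mem]
    convert monomial_mem_reesIdeal Δ lam κ (S.lift_word_sub_mem l)
    rw [AddSubgroupClass.coe_sub, S.coe_toRees (word_mem_grading Δ l), map_sub]
  exact LinearMap.congr_fun this b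

/-- The coefficients of `toRees b` lift the homogeneous components of `b`; if they all fall one
filtration step, PBW kills each component. -/
theorem toGr_injective (h : HasPBW Δ lam κ) : Function.Injective (toGr Δ lam κ) := by
  rw [injective_iff_map_eq_zero]
  intro b hb
  obtain ⟨S⟩ : Nonempty (FilteredLift Δ lam κ) := inferInstance
  rw [← S.mk_toRees, Ideal.Quotient.eq_zero_iff_mem] at hb
  apply gradingHom_injective Δ
  rw [map_zero]
  ext n
  have hn := hb n
  rw [coeff_toRees] at hn
  have h0 : canonicalMap Δ lam κ n ⟨_, coeff_gradingHom_mem Δ n b⟩ = 0 := by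
    rw [S.mk_lift, Submodule.Quotient.mk_eq_zero]
    exact hn
  exact congrArg Subtype.val ((injective_iff_map_eq_zero _).mp
    ((hasPBW_iff Δ lam κ).mp h n) _ h0)

end FilteredLift

/-! ### The Rees algebra as a graded deformation -/

variable (Δ lam κ) in
/-- The element `X` of the Rees algebra. -/
def reesX : rees Δ lam κ :=
  ⟨Polynomial.X, monomial_mem_rees Δ lam κ (filt_mono Δ lam κ zero_le_one (one_mem_filt Δ lam κ))⟩

theorem reesX_mem : reesX Δ lam κ ∈ reesIdeal Δ lam κ :=
  monomial_mem_reesIdeal Δ lam κ ((filtLT_succ Δ lam κ 0).ge (one_mem_filt Δ lam κ))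

theorem reesX_mul_comm (x : rees Δ lam κ) : reesX Δ lam κ * x = x * reesX Δ lam κ :=
  Subtype.ext Polynomial.X_mul

theorem aeval_reesX_mul_comm (p : k[X]) (x : rees Δ lam κ) :
    Polynomial.aeval (reesX Δ lam κ) p * x = x * Polynomial.aeval (reesX Δ lam κ) p := by
  induction p using Polynomial.induction_on' with
  | add p q hp hq => rw [map_add, add_mul, mul_add, hp, hq]
  | monomial n r =>
    rw [Polynomial.aeval_monomial]
    exact Commute.mul_left (Algebra.commutes r x) (Commute.pow_left (reesX_mul_comm x) n)

namespace FilteredLift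

variable (S : FilteredLift Δ lam κ)

/-- The map `B[X] → rees` extending `toRees` by linearity in `X`. -/
def polyToRees : (SmashSym V Δ)[X] →ₗ[k] rees Δ lam κ :=
  Polynomial.lsum fun n => LinearMap.mulLeft k (reesX Δ lam κ ^ n) ∘ₗ S.toRees

theorem polyToRees_monomial (n : ℕ) (b : SmashSym V Δ) :
    S.polyToRees (Polynomial.monomial n b) = reesX Δ lam κ ^ n * S.toRees b := by
  rw [polyToRees, Polynomial.lsum_apply, Polynomial.sum_monomial_index _ _ (by simp)]
  rfl

@[simp]
theorem polyToRees_C (b : SmashSym V Δ) : S.polyToRees (Polynomial.C b) = S.toRees b := by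
  rw [← Polynomial.monomial_zero_left, polyToRees_monomial, pow_zero, one_mul]

theorem polyToRees_X_mul (p : (SmashSym V Δ)[X]) :
    S.polyToRees (Polynomial.X * p) = reesX Δ lam κ * S.polyToRees p := by
  induction p using Polynomial.induction_on' with
  | add p q hp hq => rw [mul_add, map_add, map_add, mul_add, hp, hq]
  | monomial n b =>
    rw [Polynomial.X_mul_monomial, polyToRees_monomial, polyToRees_monomial, pow_succ', mul_assoc]

theorem mk_polyToRees (p : (SmashSym V Δ)[X]) :
    Ideal.Quotient.mk _ (S.polyToRees p) = toGr Δ lam κ (p.coeff 0) := by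
  conv_lhs => rw [← Polynomial.X_mul_divX_add p, map_add, polyToRees_X_mul, polyToRees_C, map_add,
    map_mul, Ideal.Quotient.eq_zero_iff_mem.mpr reesX_mem, zero_mul, zero_add, S.mk_toRees]

/-- Modulo `reesIdeal` only the constant coefficient survives, and `toGr` is injective, so that
coefficient vanishes. Then `X` can be cancelled and the argument repeated. -/
theorem polyToRees_injective (h : HasPBW Δ lam κ) : Function.Injective S.polyToRees := by
  rw [injective_iff_map_eq_zero]
  have h0 (p : (SmashSym V Δ)[X]) (hp : S.polyToRees p = 0) : p.coeff 0 = 0 := by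
    apply toGr_injective h
    rw [← S.mk_polyToRees, hp, map_zero, map_zero]
  intro p hp
  ext n
  rw [Polynomial.coeff_zero]
  induction n generalizing p with
  | zero => exact h0 p hp
  | succ n ih =>
    rw [← Polynomial.coeff_divX]
    apply ih
    have hp0 := h0 p hp
    rw [← Polynomial.X_mul_divX_add p, hp0, map_zero, add_zero, polyToRees_X_mul] at hp
    have := congrArg Subtype.val hp
    refine Subtype.ext (Polynomial.ext fun m => ?_)
    simpa [reesX] using congrArg (fun q => Polynomial.coeff q (m + 1)) this

/-- Homogeneous elements of the Rees algebra come from homogeneous elements of `B[X]`. -/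
theorem exists_polyToRees_eq {n : ℕ} {x : DeformedSmash Δ lam κ} (hx : x ∈ filt Δ lam κ n) :
    ∃ p : (SmashSym V Δ)[X], (∀ j, (∀ q, q + j = n → p.coeff j ∈ grading V Δ q) ∧
        (n < j → p.coeff j = 0)) ∧
      (S.polyToRees p : (DeformedSmash Δ lam κ)[X]) = Polynomial.monomial n x := by
  induction n generalizing x with
  | zero =>
    obtain ⟨⟨b, hb⟩, hbx⟩ := canonicalMap_surjective Δ lam κ 0 (Submodule.Quotient.mk ⟨x, hx⟩)
    rw [S.mk_lift, mk_eq_mk_iff, filtLT_zero, Submodule.mem_bot, sub_eq_zero] at hbx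
    refine ⟨Polynomial.C b, fun j => ⟨fun q hq => ?_, fun hj => ?_⟩, ?_⟩
    · obtain ⟨rfl, rfl⟩ := Nat.add_eq_zero_iff.mp hq
      simpa using hb
    · rw [Polynomial.coeff_C, if_neg hj.ne']
    · rw [polyToRees_C, S.coe_toRees hb]
      exact congrArg _ hbx
  | succ n ih =>
    -- Subtracting the lift of the top part `b` leaves an element of `F_n`; its polynomial is
    -- multiplied by `X` to restore degree `n + 1`.
    obtain ⟨⟨b, hb⟩, hbx⟩ := canonicalMap_surjective Δ lam κ _ (Submodule.Quotient.mk ⟨x, hx⟩)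
    rw [S.mk_lift, eq_comm, mk_eq_mk_iff, filtLT_succ] at hbx
    obtain ⟨p, hp, hp'⟩ := ih hbx
    refine ⟨Polynomial.X * p + Polynomial.C b, fun j => ?_, ?_⟩
    · cases j with
      | zero =>
        refine ⟨fun q hq => ?_, fun hj => by omega⟩
        obtain rfl : q = n + 1 := hq
        simpa using hb
      | succ j =>
        rw [Polynomial.coeff_add, Polynomial.coeff_X_mul, Polynomial.coeff_C_succ, add_zero]
        exact ⟨fun q hq => (hp j).1 q (by omega), fun hj => (hp j).2 (by omega)⟩
    · rw [map_add, polyToRees_X_mul, polyToRees_C, AddMemClass.coe_add, MulMemClass.coe_mul, hp',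
        S.coe_toRees hb, reesX, Polynomial.X_mul_monomial, ← map_add, sub_add_cancel]

theorem polyToRees_surjective : Function.Surjective S.polyToRees := by
  intro r
  have : r.1 ∈ (LinearMap.range S.polyToRees).map (rees Δ lam κ).val.toLinearMap := by
    rw [← Polynomial.sum_monomial_eq r.1]
    refine sum_mem fun n _ => ?_
    obtain ⟨p, _, hp⟩ := S.exists_polyToRees_eq (r.2 n)
    exact ⟨_, ⟨p, rfl⟩, hp⟩
  obtain ⟨_, ⟨p, rfl⟩, hp⟩ := this
  exact ⟨p, Subtype.ext hp⟩

/-- The linear isomorphism `rees ≃ B[X]` given by the PBW property. -/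
def reesEquiv (h : HasPBW Δ lam κ) : rees Δ lam κ ≃ₗ[k] (SmashSym V Δ)[X] :=
  (LinearEquiv.ofBijective S.polyToRees
    ⟨S.polyToRees_injective h, S.polyToRees_surjective⟩).symm

theorem reesEquiv_polyToRees (h : HasPBW Δ lam κ) (p : (SmashSym V Δ)[X]) :
    S.reesEquiv h (S.polyToRees p) = p :=
  LinearEquiv.symm_apply_apply _ p

theorem toGr_coeff_zero_reesEquiv (h : HasPBW Δ lam κ) (r : rees Δ lam κ) :
    toGr Δ lam κ ((S.reesEquiv h r).coeff 0) = Ideal.Quotient.mk _ r := by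
  obtain ⟨p, rfl⟩ := S.polyToRees_surjective r
  rw [reesEquiv_polyToRees, mk_polyToRees]

/-- The Rees algebra as a deformation of `Sym(V) ⋊ A`. -/
def deformation (h : HasPBW Δ lam κ) : Deformation k (SmashSym V Δ) :=
  letI : Algebra k[X] (rees Δ lam κ) :=
    (Polynomial.aeval (reesX Δ lam κ)).toRingHom.toAlgebra' aeval_reesX_mul_comm
  { carrier := rees Δ lam κ
    tower := IsScalarTower.of_algebraMap_eq fun r =>
      (Polynomial.aeval_C (reesX Δ lam κ) r).symm
    equiv := S.reesEquiv h
    equiv_t := fun x => by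
      obtain ⟨p, rfl⟩ := S.polyToRees_surjective x
      have : (Polynomial.X : k[X]) • S.polyToRees p = reesX Δ lam κ * S.polyToRees p :=
        congrArg (· * S.polyToRees p) (Polynomial.aeval_X (reesX Δ lam κ))
      rw [this, ← polyToRees_X_mul, reesEquiv_polyToRees, reesEquiv_polyToRees]
    -- The laws of the constant coefficient are checked after applying the injective algebra map
    -- `toGr`.
    coeff_zero_one := toGr_injective h (by
      rw [toGr_coeff_zero_reesEquiv, map_one, map_one])
    coeff_zero_mul := fun x y => toGr_injective h (by
      rw [toGr_coeff_zero_reesEquiv, map_mul, map_mul, toGr_coeff_zero_reesEquiv,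
        toGr_coeff_zero_reesEquiv]) }

theorem deformation_mu (h : HasPBW Δ lam κ) (j : ℕ) (b c : SmashSym V Δ) :
    (S.deformation h).mu j b c = (S.reesEquiv h (S.toRees b * S.toRees c)).coeff j := by
  rw [← S.polyToRees_C, ← S.polyToRees_C]
  rfl

/-- The product of two lifts is one monomial `x X^(m+n)`, whose preimage in `B[X]` has
`t^j`-coefficient of degree `m + n - j`. -/
theorem deformation_isGraded (h : HasPBW Δ lam κ) :
    (S.deformation h).IsGraded (grading V Δ) := by
  intro j m n b hb c hc
  obtain ⟨p, hp, hp'⟩ := S.exists_polyToRees_eq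
    (filt_mul_mem Δ lam κ (S.lift_mem m b hb) (S.lift_mem n c hc))
  have : S.toRees b * S.toRees c = S.polyToRees p := Subtype.ext (by
    rw [hp', MulMemClass.coe_mul, S.coe_toRees hb, S.coe_toRees hc,
      Polynomial.monomial_mul_monomial])
  rw [deformation_mu, this, reesEquiv_polyToRees]
  exact hp j

theorem deformation_recovers (h : HasPBW Δ lam κ) : Recovers Δ lam κ (S.deformation h) := by
  -- The commutator is a multiple of `X²`. The generator of `κ_V` already carries one `X`, that of
  -- `κ_A` none, hence the powers `X` and `X²`.
  have hκ (v v' : V) : reesV Δ lam κ v * reesV Δ lam κ v' - reesV Δ lam κ v' * reesV Δ lam κ v =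
      S.polyToRees (Polynomial.X * (Polynomial.C (ofV Δ 0 0 (kappaV κ v v')) +
        Polynomial.X * Polynomial.C (ofA Δ 0 0 (kappaA κ v v')))) := by
    apply Subtype.ext
    rw [reesV_mul_reesV, polyToRees_X_mul, S.polyToRees.map_add, polyToRees_X_mul, polyToRees_C, polyToRees_C,
      toRees_ofA, toRees_ofV, MulMemClass.coe_mul, AddMemClass.coe_add, MulMemClass.coe_mul,
      coe_reesA, coe_reesV, reesX, Polynomial.X_mul_monomial, ← map_add, Polynomial.X_mul_monomial]
  refine ⟨fun a v => ?_, fun v v' => ?_, fun v v' => ?_⟩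
  · have hl : reesA Δ lam κ a * reesV Δ lam κ v -
        sweedlerSum ((LinearMap.mul k _).compl₁₂ (reesV Δ lam κ) (reesA Δ lam κ)) v (Δ.comul a) =
        S.polyToRees (Polynomial.X * Polynomial.C (ofA Δ 0 0 (lam a v))) := by
      apply Subtype.ext
      rw [reesA_mul_reesV, polyToRees_X_mul, polyToRees_C, toRees_ofA, MulMemClass.coe_mul,
        coe_reesA, reesX, Polynomial.X_mul_monomial]
    let ℓ : rees Δ lam κ →ₗ[k] SmashSym V Δ :=
      ((Polynomial.lcoeff _ 1).restrictScalars k) ∘ₗ (S.reesEquiv h).toLinearMap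
    have hs : sweedlerSum (((S.deformation h).mu 1).compl₁₂ (ofV Δ 0 0) (ofA Δ 0 0)) v (Δ.comul a) =
        ℓ (sweedlerSum ((LinearMap.mul k _).compl₁₂ (reesV Δ lam κ) (reesA Δ lam κ)) v
          (Δ.comul a)) := by
      rw [map_sweedlerSum]
      congr 2
      refine LinearMap.ext₂ fun v a => ?_
      rw [LinearMap.compl₁₂_apply, deformation_mu, toRees_ofV, toRees_ofA]
      rfl
    rw [hs, deformation_mu, toRees_ofV, toRees_ofA]
    refine Eq.trans ?_ (map_sub ℓ _ _)
    rw [hl]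
    simp [ℓ, reesEquiv_polyToRees]
  · rw [deformation_mu, deformation_mu, toRees_ofV, toRees_ofV, ← Polynomial.coeff_sub, ← map_sub,
      hκ, reesEquiv_polyToRees]
    simp
  · rw [deformation_mu, deformation_mu, toRees_ofV, toRees_ofV, ← Polynomial.coeff_sub, ← map_sub,
      hκ, reesEquiv_polyToRees]
    simp

end FilteredLift

end ReesDeformation

end PBWDeform

end

theorem theorem3p1 {k : Type*} {A : Type*} {V : Type*} [Field k] [Ring A] [Algebra k A]
    [AddCommGroup V] [Module k V] [Module A V] [IsScalarTower k A V]
    (Δ : PBWDeform.CocommutativeCoproduct k A) (lam : A →ₗ[k] V →ₗ[k] A)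
    (κ : V [⋀^Fin 2]→ₗ[k] (V × A)) :
    (PBWDeform.HasPBW Δ lam κ →
      ∃ D : PBWDeform.Deformation k (PBWDeform.SmashSym V Δ),
        D.IsGraded (PBWDeform.grading V Δ) ∧ PBWDeform.Recovers Δ lam κ D) ∧
    (FiniteDimensional k A → FiniteDimensional k V →
      (∃ D : PBWDeform.Deformation k (PBWDeform.SmashSym V Δ),
        D.IsGraded (PBWDeform.grading V Δ) ∧ PBWDeform.Recovers Δ lam κ D) →
      PBWDeform.HasPBW Δ lam κ) ∧
    (PBWDeform.HasPBW Δ lam κ →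
      ∀ D : PBWDeform.Deformation k (PBWDeform.SmashSym V Δ),
        D.IsGraded (PBWDeform.grading V Δ) → PBWDeform.Recovers Δ lam κ D →
        ∃ φ : PBWDeform.DeformedSmash Δ lam κ ≃ₐ[k] D.AtOne,
          (∀ a : A, φ (PBWDeform.ofA Δ lam κ a) = D.toAtOne (PBWDeform.ofA Δ 0 0 a)) ∧
          (∀ v : V, φ (PBWDeform.ofV Δ lam κ v) = D.toAtOne (PBWDeform.ofV Δ 0 0 v))) := by
  refine ⟨fun h => ?_, fun _ _ ⟨_, hD, hR⟩ => PBWDeform.hasPBW_of_recovers hD hR,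
    fun _ D hD hR => ?_⟩
  · obtain ⟨S⟩ : Nonempty (PBWDeform.FilteredLift Δ lam κ) := inferInstance
    exact ⟨S.deformation h, S.deformation_isGraded h, S.deformation_recovers h⟩
  · exact ⟨AlgEquiv.ofBijective (PBWDeform.toSpecialization hD hR)
      ⟨PBWDeform.toSpecialization_injective hD hR, PBWDeform.toSpecialization_surjective hD hR⟩,
      PBWDeform.toSpecialization_ofA hD hR, PBWDeform.toSpecialization_ofV hD hR⟩
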